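/- **Setting.** Fix a finite field $\mathbb F_q$; all entropies are in $q$-ary units. Messages $W_e$, each consisting of $L\ge 1$ symbols, are independent and uniform over $\mathbb F_q^{L}$, and each message is stored on exactly two of $N$ non-colluding servers. For a simple connected graph $G$ with $N\ge 2$ vertices (servers) and $K'$ edges there is one message per edge, stored on its two endpoints; for the multigraph $G^{(r)}$, $r\ge 1$, every edge $k$ carries $r$ messages $W_{k,1},\dots,W_{k,r}$. The servers may all share common randomness $\mathcal R$ (fully-replicated randomness), independent of the messages. The user's private randomness $\mathcal Q$ is independent of messages and $\mathcal R$. To retrieve message $\theta$, the user sends to server $n$ a query $Q_n^{[\theta]}$, a function of $\mathcal Q$; the server answers with a string $A_n^{[\theta]}$ of symbols of $\mathbb F_q$ that is a function of $Q_n^{[\theta]}$, its stored messages $\mathcal W_n$, and $\mathcal R$. A scheme is an *SPIR scheme with fully-replicated randomness* if it satisfies user privacy (the law of $(Q_n^{[\theta]},A_n^{[\theta]},\mathcal W_n,\mathcal R)$ does not depend on $\theta$, for every $n$), reliability ($H(W_\theta\mid A_{1:N}^{[\theta]},\mathcal Q)=0$) and database privacy ($I(\mathcal W\setminus\{W_\theta\};A_{1:N}^{[\theta]},Q_{1:N}^{[\theta]},\mathcal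 Q)=0$). Its rate is $L/\sum_n H(A_n^{[\theta]})$ and its total randomness ratio is $\rho_{total}=H(\mathcal R)/L$. $\mathscr C_{FR}$ and $\rho^*_{total}$ denote the supremum of the rates and the infimum of the total randomness ratios over all such schemes. A *PIR scheme* is a scheme without server randomness that satisfies user privacy and reliability; it is *linear* if every answer symbol is an $\mathbb F_q$-linear combination of symbols stored on the answering server (for example, a sum of symbols of distinct messages). It satisfies the *symmetric retrieval property* (SRP) if for every message $k$, each server $n$ storing $W_k$, and every query value $\mathsf q$ sent with positive probability, exactly half of the symbols of $W_k$ are retrieved from $n$: $H(A_n^{[k]}\mid Q_n^{[k]}=\mathsf q,\mathcal W_n\setminus\{W_k\})=\tfrac12H(W_k)$. **Theorem.** Let $T$ be a linear PIR scheme on $G$ that satisfies SRP, with $L'$ symbols per message (so $L'$ is even) and download $D'=\sum_nH(A_n^{[k]})$. Put $\ell=\mathrm{lcm}(L'/2,N-1)$, $x=\frac{\ell}{L'/2}$, $y=\frac{\ell}{N-1}$. Then there is an SPIR scheme with fully-replicated randomness on $G^{(r)}$, with $2^{r-1}L'x$ symbols per message, of rate $$R_{FR}(G^{(r)})=\frac{2^{r-1}L'x}{(2^r-1)D'x+Ny}$$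 and total randomness ratio $$\rho_{total}(G^{(r)})=\frac{Ny}{2^{r-1}xL'}-\frac{K'+1}{2^r}+K' .$$ The same scheme transmits exactly $(2^r-1)D'_0x+Ny$ answer symbols, where $D'_0$ is the number of answer symbols transmitted in $T$. Consequently $\mathscr C_{FR}(G^{(r)})\ge R_{FR}(G^{(r)})$ and $\rho^*_{total}(G^{(r)})\le\rho_{total}(G^{(r)})$. In particular, for the path $\mathbb P_N$ ($N\ge2$) and the cycle $\mathbb C_N$ ($N\ge3$) on $N$ vertices there are SPIR schemes with fully-replicated randomness on $\mathbb P_N^{(r)}$ and $\mathbb C_N^{(r)}$ with, respectively, $$R_{FR}(\mathbb P_N^{(r)})=\frac{2}{N(2-2^{1-r})+\frac{N}{N-1}2^{1-r}},\qquad \rho_{total}(\mathbb P_N^{(r)})=\frac1{R_{FR}(\mathbb P_N^{(r)})}-1=\frac1{N-1}+\frac{N(N-2)}{2(N-1)}(2-2^{1-r}),$$ $$R_{FR}(\mathbb C_N^{(r)})=\frac{2}{(N+1)(2-2^{1-r})+\frac{N}{N-1}2^{1-r}},\qquad \rho_{total}(\mathbb C_N^{(r)})=\frac1{R_{FR}(\mathbb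 C_N^{(r)})}-1=\frac1{N-1}+\frac{N^2-N-1}{2(N-1)}(2-2^{1-r}),$$ so that these rates are lower bounds for $\mathscr C_{FR}$, and these ratios upper bounds for $\rho^*_{total}$, of $\mathbb P_N^{(r)}$ and $\mathbb C_N^{(r)}$. -/

import Mathlib

namespace GraphPIR

noncomputable section

/-! Finite information theory. -/

/-- The uniform distribution on a nonempty finite type. -/
def uniform (α : Type*) [Finite α] [Nonempty α] : PMF α :=
  letI := Fintype.ofFinite α
  PMF.uniformOfFintype α

/-- The product distribution of two independent variables. -/
def indepProd {α β : Type*} (p : PMF α) (p' : PMF β) : PMF (α × β) :=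
  p.bind fun a => p'.map fun b => (a, b)

/-- Shannon entropy `H(X)` in base `b` of a random variable `X` on a (finite) probability space
with law `p`, as the mean of `-log_b P(X = X(ω))`. -/
def entropy (b : ℕ) {Ω α : Type*} (p : PMF Ω) (X : Ω → α) : ℝ :=
  ∑' ω, (p ω).toReal * -Real.logb b ((p.map X) (X ω)).toReal

/-- Conditional entropy `H(X | Y) = H(X, Y) - H(Y)`. -/
def condEntropy (b : ℕ) {Ω α β : Type*} (p : PMF Ω) (X : Ω → α) (Y : Ω → β) : ℝ :=
  entropy b p (fun ω => (X ω, Y ω)) - entropy b p Y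

/-- Mutual information `I(X; Y) = H(X) + H(Y) - H(X, Y)`. -/
def mutualInfo (b : ℕ) {Ω α β : Type*} (p : PMF Ω) (X : Ω → α) (Y : Ω → β) : ℝ :=
  entropy b p X + entropy b p Y - entropy b p (fun ω => (X ω, Y ω))

/-! Graph-replicated storage. A storage system is given by a map `ends : E → Sym2 V`: messages are
indexed by `E`, servers by `V`, and message `e` is stored on the two servers in `ends e`. -/

/-- The storage system of a simple graph: one message per edge. -/
def graphStorage {V : Type*} (G : SimpleGraph V) : G.edgeSet → Sym2 V :=
  fun e => e.1

/-- The storage system of the `r`-multigraph of `G`: every edge is replaced by `r` parallel ones. -/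
def multigraphStorage {V : Type*} (G : SimpleGraph V) (r : ℕ) : G.edgeSet × Fin r → Sym2 V :=
  fun e => e.1.1

/-- The part of the database `w` that is stored on server `v`. -/
def storedPart {F V E : Type*} (ends : E → Sym2 V) {L : ℕ} (v : V) (w : E → Fin L → F) :
    {e : E // v ∈ ends e} → Fin L → F :=
  fun e => w e.1

/-- A one-round retrieval protocol over `F` for the storage system `ends`, with common randomness
`R` that is available to all servers. -/
structure Protocol (F : Type*) {V E : Type*} (ends : E → Sym2 V) where
  /-- number of symbols per message -/
  L : ℕ
  L_pos : 0 < L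
  /-- values of the user's private randomness `𝒬` -/
  U : Type
  finite_U : Finite U
  userLaw : PMF U
  /-- values of the servers' common randomness `ℛ` -/
  R : Type
  finite_R : Finite R
  randLaw : PMF R
  Query : V → Type
  /-- the query to server `v` for the desired message `k`, a function of `𝒬` -/
  query : E → (v : V) → U → Query v
  /-- number of symbols downloaded from server `v` -/
  len : V → ℕ
  /-- the answer of server `v`, a function of its query, its messages and `ℛ` -/
  answer : (v : V) → Query v → ({e : E // v ∈ ends e} → Fin L → F) → R → Fin (len v) → F

namespace Protocol

variable {F : Type*} [Field F] [Finite F] {V E : Type*} [Finite E] {ends : E → Sym2 V}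

/-- The law of the content of the servers: uniform messages and, independently, `ℛ`. -/
def contentLaw (P : Protocol F ends) : PMF ((E → Fin P.L → F) × P.R) :=
  indepProd (uniform (E → Fin P.L → F)) P.randLaw

/-- The joint law of `(𝒬, (𝒲, ℛ))`: the user's randomness is independent of the content. -/
def law (P : Protocol F ends) : PMF (P.U × (E → Fin P.L → F) × P.R) :=
  indepProd P.userLaw P.contentLaw

/-- The answer `A_v^{[k]}` as a random variable. -/
def ans (P : Protocol F ends) (k : E) (v : V) (ω : P.U × (E → Fin P.L → F) × P.R) :
    Fin (P.len v) → F :=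
  P.answer v (P.query k v ω.1) (storedPart ends v ω.2.1) ω.2.2

/-- User privacy: `(Q_v^{[k]}, A_v^{[k]}, 𝒲_v, ℛ)` has the same law for all desired `k`. -/
def UserPrivacy (P : Protocol F ends) : Prop :=
  ∀ (v : V) (k k' : E),
    P.law.map (fun ω => (P.query k v ω.1, P.ans k v ω, storedPart ends v ω.2.1, ω.2.2)) =
    P.law.map (fun ω => (P.query k' v ω.1, P.ans k' v ω, storedPart ends v ω.2.1, ω.2.2))

/-- Reliability: `H(W_k | A_{1:N}^{[k]}, 𝒬) = 0`. -/
def Reliable (P : Protocol F ends) : Prop :=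
  ∀ k : E, condEntropy (Nat.card F) P.law
    (fun ω => ω.2.1 k) (fun ω => ((fun v => P.ans k v ω), ω.1)) = 0

/-- Database privacy: `I(𝒲 \ W_k; A_{1:N}^{[k]}, Q_{1:N}^{[k]}, 𝒬) = 0`. -/
def DatabasePrivacy (P : Protocol F ends) : Prop :=
  ∀ k : E, mutualInfo (Nat.card F) P.law
    (fun ω => fun e : {e : E // e ≠ k} => ω.2.1 e.1)
    (fun ω => ((fun v => P.ans k v ω), (fun v => P.query k v ω.1), ω.1)) = 0

/-- A PIR scheme: no server-side randomness, user privacy and reliability. -/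
structure IsPIR (P : Protocol F ends) : Prop where
  no_randomness : Subsingleton P.R
  userPrivacy : P.UserPrivacy
  reliable : P.Reliable

/-- An SPIR scheme with fully-replicated common randomness. -/
structure IsSPIR (P : Protocol F ends) : Prop where
  userPrivacy : P.UserPrivacy
  reliable : P.Reliable
  databasePrivacy : P.DatabasePrivacy

/-- Every downloaded symbol is a linear combination of symbols stored on the answering server. -/
def IsLinear (P : Protocol F ends) : Prop :=
  ∀ (v : V) (q : P.Query v) (s : P.R),
    ∃ f : ({e : E // v ∈ ends e} → Fin P.L → F) →ₗ[F] (Fin (P.len v) → F),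
      ∀ w, P.answer v q w s = f w

/-- Symmetric retrieval property: from each of the two servers `v` that store the desired message
`W_k`, and for every realization of the query, exactly half of the symbols of `W_k` are retrieved,
`H(A_v^{[k]} | Q_v^{[k]} = q, 𝒲_v \ W_k) = H(W_k) / 2 = L / 2`. -/
def SRP (P : Protocol F ends) : Prop :=
  ∀ (k : E) (v : V), v ∈ ends k → ∀ u ∈ P.userLaw.support,
    condEntropy (Nat.card F) P.contentLaw
      (fun c => P.answer v (P.query k v u) (storedPart ends v c.1) c.2)
      (fun c => fun e : {e : E // v ∈ ends e ∧ e ≠ k} => c.1 e.1) = (P.L : ℝ) / 2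

/-- The download `∑_v H(A_v^{[k]})`, in `q`-ary units. -/
def download [Fintype V] (P : Protocol F ends) (k : E) : ℝ :=
  ∑ v, entropy (Nat.card F) P.law (P.ans k v)

/-- The number of transmitted symbols. -/
def numSymbols [Fintype V] (P : Protocol F ends) : ℕ :=
  ∑ v, P.len v

/-- The rate `L / ∑_v H(A_v^{[k]})`. -/
def rate [Fintype V] (P : Protocol F ends) (k : E) : ℝ :=
  P.L / P.download k

/-- The total randomness ratio `H(ℛ) / L`. -/
def randomnessRatio (P : Protocol F ends) : ℝ :=
  entropy (Nat.card F) P.randLaw id / P.L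

end Protocol

/-- The SPIR capacity with fully-replicated randomness: the supremum of the achievable rates. -/
def capacityFR (F : Type*) [Field F] [Finite F] {V E : Type*} [Fintype V] [Finite E]
    (ends : E → Sym2 V) : EReal :=
  ⨆ (P : Protocol F ends) (_ : P.IsSPIR) (k : E), ((P.rate k : ℝ) : EReal)

/-- The optimum total randomness ratio: the infimum over all SPIR schemes. -/
def optRandomnessRatio (F : Type*) [Field F] [Finite F] {V E : Type*} [Finite E]
    (ends : E → Sym2 V) : EReal :=
  ⨅ (P : Protocol F ends) (_ : P.IsSPIR), ((P.randomnessRatio : ℝ) : EReal)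

/-- `x = ℓ / (L/2)`, where `ℓ = lcm(L/2, N-1)`, for even `L`. -/
def xRep (L N : ℕ) : ℕ := Nat.lcm (L / 2) (N - 1) / (L / 2)

/-- `y = ℓ / (N-1)`, where `ℓ = lcm(L/2, N-1)`, for even `L`. -/
def yRep (L N : ℕ) : ℕ := Nat.lcm (L / 2) (N - 1) / (N - 1)

end

end GraphPIR

namespace GraphPIR

noncomputable section

open Finset

/-! ### Laws on finite types -/

section Laws

variable {ι α β γ Ω Ω' : Type*}

/-! The proof passes through `AlignedCode`. In a linear PIR scheme with SRP, an answer depends on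
each stored message through a linear map of rank h = L'/2, so a server encodes one block of h
symbols per message. Reliability yields a linear decoder. An unwanted message cancels in it, so the
decoder maps the block spaces at its two servers onto the same subspace, and an automorphism ties
the two blocks so that every tied pair cancels, whether or not it comes from a message. The two
blocks of the wanted message together have 2h = L' dimensions, so both are recovered. This is
`Protocol.exists_alignedCode`.

In the symmetric scheme, a wanted message is a pair (k, τ), and x copies of the code are run for
every nonempty set S of parallel messages, on masked sums of pieces. The key consists of a random
bijection from each message to its pieces (two for each S containing τ), a random permutation of the
masks of each edge, and a random function f of all masks. The first server of an edge uses the key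
as it is, the second one a twisted key. On an edge e ≠ k the twist applies the alignment. On k it
moves the sum of S ∆ {τ} to S, so that the mask and the other parallel messages agree with a sum
known from the first server, while the message τ supplies a fresh piece (`mix_twist`). Comparing the
decoded blocks gives the wanted pieces, except that for S = {τ}, where S ∆ {τ} is empty, only the
difference of two pieces results. So the mask of {τ} is retrieved as well: every server returns t +
f(s), where s collects all masks and t is common noise, and f is shifted at each server other than
v₀ by a share of the wanted mask. The N-1 shares of y symbols make up the xh symbols of that mask,
whence xh = (N-1)y.

User privacy holds because a twisted uniform key is uniform (`twist_injective`). Database privacy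
holds because (s, t) ↦ (blocks of the first servers, t + f(s)) is a bijection for a fixed key and
fixed messages (`mask_injective`): all answers are functions of the user's randomness, the wanted
message and this uniform noise.

For paths and cycles aligned codes are written down directly. They need no user randomness, since
the random key already hides the wanted message. -/

theorem uniform_apply (α : Type*) [Finite α] [Nonempty α] (a : α) :
    uniform α a = (Nat.card α : ENNReal)⁻¹ := by
  let _ := Fintype.ofFinite α
  rw [uniform, PMF.uniformOfFintype_apply, Nat.card_eq_fintype_card]

theorem mem_support_uniform [Finite α] [Nonempty α] (a : α) : a ∈ (uniform α).support := by
  rw [PMF.mem_support_iff, uniform_apply]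
  simp

theorem indepProd_apply (p : PMF α) (p' : PMF β) (x : α × β) :
    indepProd p p' x = p x.1 * p' x.2 := by
  classical
  obtain ⟨a, b⟩ := x
  rw [indepProd, PMF.bind_apply, tsum_eq_single a]
  · congr 1
    rw [PMF.map_apply, tsum_eq_single b]
    · simp
    · intro b' hb'
      simp [Prod.ext_iff, hb'.symm]
  · intro a' ha'
    rw [PMF.map_apply]
    simp [Prod.ext_iff, ha'.symm]

theorem mem_support_indepProd (p : PMF α) (p' : PMF β) (x : α × β) :
    x ∈ (indepProd p p').support ↔ x.1 ∈ p.support ∧ x.2 ∈ p'.support := by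
  simp only [PMF.mem_support_iff, indepProd_apply, ne_eq, mul_eq_zero, not_or]

theorem indepProd_bind (p : PMF α) (p' : PMF β) (f : α × β → PMF γ) :
    (indepProd p p').bind f = p.bind fun a => p'.bind fun b => f (a, b) := by
  rw [indepProd, PMF.bind_bind]
  simp only [PMF.bind_map, Function.comp_def]

theorem map_eq_bind (p : PMF α) (f : α → β) : p.map f = p.bind fun a => PMF.pure (f a) := rfl

theorem indepProd_map (p : PMF α) (p' : PMF β) (f : α × β → γ) :
    (indepProd p p').map f = p.bind fun a => p'.map fun b => f (a, b) :=
  indepProd_bind p p' _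

theorem bind_congr_support (p : PMF α) {f g : α → PMF β} (h : ∀ a ∈ p.support, f a = g a) :
    p.bind f = p.bind g := by
  ext b
  rw [PMF.bind_apply, PMF.bind_apply]
  refine tsum_congr fun a => ?_
  by_cases ha : a ∈ p.support
  · rw [h a ha]
  · rw [PMF.mem_support_iff, not_not] at ha
    rw [ha, zero_mul, zero_mul]

theorem indepProd_map_map {α' β' : Type*} (p : PMF α) (p' : PMF β) (f : α → α') (g : β → β') :
    (indepProd p p').map (fun x => (f x.1, g x.2)) = indepProd (p.map f) (p'.map g) := by
  rw [indepProd_map, indepProd, PMF.bind_map]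
  simp only [PMF.map_comp, Function.comp_def]

theorem indepProd_map_fst (p : PMF α) (p' : PMF β) : (indepProd p p').map Prod.fst = p := by
  rw [indepProd_map]
  simp only [map_eq_bind, PMF.bind_const, PMF.bind_pure]

theorem indepProd_map_snd (p : PMF α) (p' : PMF β) : (indepProd p p').map Prod.snd = p' := by
  rw [indepProd_map]
  simp only [map_eq_bind, PMF.bind_const, PMF.bind_pure]

/-- A map all of whose fibres have the same size sends the uniform law to the uniform law. -/
theorem uniform_map_of_equiv_prod [Finite α] [Nonempty α] [Finite β] [Nonempty β]
    [Finite γ] (e : α ≃ β × γ) : (uniform α).map (fun a => (e a).1) = uniform β := by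
  classical
  let _ := Fintype.ofFinite α
  let _ := Fintype.ofFinite β
  let _ := Fintype.ofFinite γ
  have : Nonempty γ := ⟨(e (Classical.arbitrary α)).2⟩
  ext b
  rw [PMF.map_apply, tsum_fintype, uniform_apply]
  simp only [uniform_apply]
  rw [← Equiv.sum_comp e.symm]
  simp only [Equiv.apply_symm_apply, Fintype.sum_prod_type]
  rw [Finset.sum_eq_single b]
  · rw [Nat.card_congr e, Nat.card_prod]
    simp only [if_true, Finset.sum_const, Finset.card_univ, nsmul_eq_mul, Nat.card_eq_fintype_card,
      Nat.cast_mul]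
    rw [ENNReal.mul_inv (by simp) (by simp), mul_comm, mul_assoc,
      ENNReal.inv_mul_cancel (by simp) (by simp), mul_one]
  · intro b' _ hb'
    simp [hb'.symm]
  · simp

theorem uniform_map_equiv [Finite α] [Nonempty α] [Finite β] [Nonempty β] (e : α ≃ β) :
    (uniform α).map e = uniform β :=
  uniform_map_of_equiv_prod (e.trans (Equiv.prodPUnit.{0} β).symm)

theorem uniform_map_injective [Finite α] [Nonempty α] {f : α → α} (hf : Function.Injective f) :
    (uniform α).map f = uniform α :=
  uniform_map_equiv (Equiv.ofBijective f (Finite.injective_iff_bijective.1 hf))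

theorem uniform_prod [Finite α] [Nonempty α] [Finite β] [Nonempty β] :
    uniform (α × β) = indepProd (uniform α) (uniform β) := by
  ext x
  rw [indepProd_apply, uniform_apply, uniform_apply, uniform_apply, Nat.card_prod, Nat.cast_mul,
    ENNReal.mul_inv (by simp) (by simp)]

/-- The restriction of a uniform tuple to a set of coordinates is uniform. -/
theorem uniform_map_restrict [Finite ι] [Finite α] [Nonempty α] (P : ι → Prop) :
    (uniform (ι → α)).map (fun f (i : {i // P i}) => f i.1) = uniform ({i // P i} → α) := by
  classical
  exact uniform_map_of_equiv_prod (Equiv.piEquivPiSubtypeProd P fun _ => α)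

/-- The law of a tuple of independent variables. -/
def piLaw [Finite ι] [Finite α] (p : ι → PMF α) : PMF (ι → α) :=
  letI := Fintype.ofFinite ι
  letI := Fintype.ofFinite α
  letI := Classical.decEq ι
  PMF.ofFintype (fun f => ∏ i, p i (f i)) (by
    rw [← Fintype.piFinset_univ, ← Finset.prod_univ_sum]
    refine Finset.prod_eq_one fun i _ => ?_
    rw [← tsum_fintype (L := .unconditional _)]
    exact (p i).tsum_coe)

theorem piLaw_apply [Fintype ι] [Finite α] (p : ι → PMF α) (f : ι → α) :
    piLaw p f = ∏ i, p i (f i) := by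
  change @Finset.prod ι _ _ (@Finset.univ ι (Fintype.ofFinite ι)) _ = _
  congr!

theorem piLaw_map_apply [Fintype ι] [Finite α] (p : ι → PMF α) (g : ι → α → β) (f : ι → β) :
    (piLaw p).map (fun u i => g i (u i)) f = ∏ i, (p i).map (g i) (f i) := by
  classical
  let _ := Fintype.ofFinite α
  simp only [PMF.map_apply, tsum_fintype, piLaw_apply]
  rw [Finset.prod_univ_sum, Fintype.piFinset_univ]
  refine Finset.sum_congr rfl fun u _ => ?_
  rw [Finset.prod_ite_zero]
  by_cases h : ∀ i, f i = g i (u i)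
  · rw [if_pos (funext h), if_pos fun i _ => h i]
  · rw [if_neg fun h' => h (congrFun h'), if_neg fun h' => h fun i => h' i (mem_univ i)]

theorem piLaw_bind [Finite ι] [Finite α] [Finite β] (p : ι → PMF α) (κ : ι → α → PMF β) :
    ((piLaw p).bind fun u => piLaw fun i => κ i (u i)) = piLaw fun i => (p i).bind (κ i) := by
  classical
  let _ := Fintype.ofFinite α
  let _ := Fintype.ofFinite ι
  ext f
  simp only [PMF.bind_apply, tsum_fintype, piLaw_apply]
  rw [Finset.prod_univ_sum, Fintype.piFinset_univ]
  exact Finset.sum_congr rfl fun u _ => Finset.prod_mul_distrib.symm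

theorem piLaw_map [Finite ι] [Finite α] [Finite β] (p : ι → PMF α) (g : ι → α → β) :
    (piLaw p).map (fun u i => g i (u i)) = piLaw fun i => (p i).map (g i) := by
  let _ := Fintype.ofFinite ι
  ext f
  rw [piLaw_map_apply, piLaw_apply]

theorem mem_support_piLaw [Finite ι] [Finite α] (p : ι → PMF α) (f : ι → α) :
    f ∈ (piLaw p).support ↔ ∀ i, f i ∈ (p i).support := by
  let _ := Fintype.ofFinite ι
  simp only [PMF.mem_support_iff, piLaw_apply, Finset.prod_ne_zero_iff, Finset.mem_univ,
    forall_true_left]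

theorem uniform_pi [Finite ι] [Finite α] [Nonempty α] :
    uniform (ι → α) = piLaw fun _ : ι => uniform α := by
  let _ := Fintype.ofFinite ι
  ext f
  rw [piLaw_apply, uniform_apply]
  simp only [uniform_apply]
  rw [Finset.prod_const, Nat.card_fun, Finset.card_univ, Nat.card_eq_fintype_card (α := ι),
    Nat.cast_pow, ENNReal.inv_pow]

/-- Exchanging the two arguments of a uniform table. -/
theorem uniform_map_swap {ι' : Type*} [Finite ι] [Finite ι'] [Finite α] [Nonempty α] :
    (uniform (ι → ι' → α)).map (fun f i' i => f i i') = uniform (ι' → ι → α) :=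
  uniform_map_equiv (Equiv.piComm fun _ _ => α)

end Laws

/-! ### Entropy -/

section Entropy

variable {α β γ Ω Ω' : Type*} {b : ℕ}

theorem entropy_eq_sum [Fintype Ω] (p : PMF Ω) (X : Ω → α) :
    entropy b p X = ∑ ω, (p ω).toReal * -Real.logb b ((p.map X) (X ω)).toReal :=
  tsum_fintype _

theorem map_apply_toReal [Fintype Ω] [DecidableEq α] (p : PMF Ω) (X : Ω → α) (a : α) :
    (p.map X a).toReal = ∑ ω, if a = X ω then (p ω).toReal else 0 := by
  rw [PMF.map_apply, tsum_fintype, ENNReal.toReal_sum]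
  · refine Finset.sum_congr rfl fun ω _ => ?_
    convert apply_ite ENNReal.toReal _ _ _
    simp
  · intro ω _
    split_ifs
    · exact p.apply_ne_top ω
    · simp

theorem map_apply_pos {p : PMF Ω} (X : Ω → α) {ω : Ω} (hω : ω ∈ p.support) :
    0 < (p.map X (X ω)).toReal := by
  refine ENNReal.toReal_pos ?_ ((p.map X).apply_ne_top _)
  rw [← PMF.mem_support_iff, PMF.support_map]
  exact ⟨ω, hω, rfl⟩

variable [Finite Ω] [Finite Ω']

theorem entropy_pair_of_indep (p : PMF Ω) (X : Ω → α) (Y : Ω → β) (μ : PMF α) (ν : PMF β)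
    (h : p.map (fun ω => (X ω, Y ω)) = indepProd μ ν) :
    entropy b p (fun ω => (X ω, Y ω)) = entropy b p X + entropy b p Y := by
  classical
  let _ := Fintype.ofFinite Ω
  have hX : p.map X = μ := by
    have := congrArg (PMF.map Prod.fst) h
    rwa [PMF.map_comp, indepProd_map_fst] at this
  have hY : p.map Y = ν := by
    have := congrArg (PMF.map Prod.snd) h
    rwa [PMF.map_comp, indepProd_map_snd] at this
  rw [entropy_eq_sum, entropy_eq_sum, entropy_eq_sum, ← Finset.sum_add_distrib]
  refine Finset.sum_congr rfl fun ω _ => ?_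
  by_cases hω : ω ∈ p.support
  · rw [h, indepProd_apply, ← hX, ← hY, ENNReal.toReal_mul,
      Real.logb_mul (map_apply_pos X hω).ne' (map_apply_pos Y hω).ne']
    ring
  · rw [PMF.mem_support_iff, not_not] at hω
    simp [hω]

theorem mutualInfo_eq_zero_of_indep (p : PMF Ω) (X : Ω → α) (Y : Ω → β) (μ : PMF α) (ν : PMF β)
    (h : p.map (fun ω => (X ω, Y ω)) = indepProd μ ν) : mutualInfo b p X Y = 0 := by
  rw [mutualInfo, entropy_pair_of_indep p X Y μ ν h, sub_self]

/-- Grouping the outcomes by the value of X removes the sample space, so that variables on different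
spaces can be compared. -/
theorem entropy_eq_tsum_law (p : PMF Ω) (X : Ω → α) :
    entropy b p X = ∑' a, (p.map X a).toReal * -Real.logb b (p.map X a).toReal := by
  classical
  let _ := Fintype.ofFinite Ω
  rw [entropy_eq_sum, tsum_eq_sum (s := Finset.univ.image X)]
  · rw [← Finset.sum_fiberwise_of_maps_to (t := Finset.univ.image X) (g := X)
      (fun ω _ => Finset.mem_image_of_mem X (Finset.mem_univ ω))]
    refine Finset.sum_congr rfl fun a _ => ?_
    rw [map_apply_toReal p X a, Finset.sum_mul, Finset.sum_filter]
    refine Finset.sum_congr rfl fun ω _ => ?_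
    by_cases h : X ω = a
    · rw [if_pos h, if_pos h.symm, h, map_apply_toReal p X a]
    · rw [if_neg h, if_neg (Ne.symm h), zero_mul]
  · intro a ha
    have : p.map X a = 0 := by
      rw [PMF.apply_eq_zero_iff, PMF.support_map]
      rintro ⟨ω, _, rfl⟩
      exact ha (Finset.mem_image_of_mem X (Finset.mem_univ ω))
    rw [this]
    simp

/-- Entropy only depends on the law. -/
theorem entropy_congr_law {p : PMF Ω} {p' : PMF Ω'} {X : Ω → α} {X' : Ω' → α}
    (h : p.map X = p'.map X') : entropy b p X = entropy b p' X' := by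
  rw [entropy_eq_tsum_law, entropy_eq_tsum_law, h]

theorem entropy_map (p : PMF Ω) (X : Ω → Ω') : entropy b (p.map X) id = entropy b p X :=
  entropy_congr_law (PMF.map_id _)

theorem entropy_comp_injective (p : PMF Ω) (X : Ω → α) {f : α → β} (hf : Function.Injective f) :
    entropy b p (fun ω => f (X ω)) = entropy b p X := by
  classical
  let _ := Fintype.ofFinite Ω
  rw [entropy_eq_sum, entropy_eq_sum]
  refine Finset.sum_congr rfl fun ω _ => ?_
  simp only [map_apply_toReal, hf.eq_iff]

theorem map_pair_apply_le (p : PMF Ω) (X : Ω → α) (Y : Ω → β) (ω : Ω) :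
    (p.map (fun ω => (X ω, Y ω)) (X ω, Y ω)).toReal ≤ (p.map Y (Y ω)).toReal := by
  classical
  let _ := Fintype.ofFinite Ω
  rw [map_apply_toReal, map_apply_toReal]
  refine Finset.sum_le_sum fun ω' _ => ?_
  split_ifs with h1 h2
  · exact le_rfl
  · exact absurd (Prod.ext_iff.1 h1).2 h2
  · exact ENNReal.toReal_nonneg
  · exact le_rfl

/-- The conditional entropy vanishes exactly if `X` is a function of `Y` on the support. -/
theorem condEntropy_eq_zero_iff (hb : 1 < b) (p : PMF Ω) (X : Ω → α) (Y : Ω → β) :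
    condEntropy b p X Y = 0 ↔
      ∀ ω ∈ p.support, ∀ ω' ∈ p.support, Y ω = Y ω' → X ω = X ω' := by
  classical
  let _ := Fintype.ofFinite Ω
  have hb' : (1 : ℝ) < b := by exact_mod_cast hb
  -- Every term of this sum is nonnegative, since the event for (X, Y) is contained in the event for
  -- Y.
  have key : condEntropy b p X Y = ∑ ω, (p ω).toReal * (Real.logb b (p.map Y (Y ω)).toReal -
      Real.logb b (p.map (fun ω => (X ω, Y ω)) (X ω, Y ω)).toReal) := by
    rw [condEntropy, entropy_eq_sum, entropy_eq_sum, ← Finset.sum_sub_distrib]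
    exact Finset.sum_congr rfl fun ω _ => by ring
  have hlog : ∀ ω ∈ p.support, Real.logb b (p.map (fun ω => (X ω, Y ω)) (X ω, Y ω)).toReal ≤
      Real.logb b (p.map Y (Y ω)).toReal := fun ω hω =>
    Real.logb_le_logb_of_le hb' (map_apply_pos (fun ω => (X ω, Y ω)) hω) (map_pair_apply_le p X Y ω)
  have hpos : ∀ ω ∈ p.support, 0 < (p ω).toReal := fun ω hω =>
    ENNReal.toReal_pos hω (p.apply_ne_top ω)
  rw [key, Finset.sum_eq_zero_iff_of_nonneg]
  · constructor
    · intro h ω hω ω' hω' hY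
      by_contra hX
      have h1 := (mul_eq_zero.1 (h ω (Finset.mem_univ ω))).resolve_left (hpos ω hω).ne'
      have h2 : (p.map Y (Y ω)).toReal = (p.map (fun ω => (X ω, Y ω)) (X ω, Y ω)).toReal :=
        Real.logb_injOn_pos hb' (map_apply_pos Y hω)
          (map_apply_pos (fun ω => (X ω, Y ω)) hω) (sub_eq_zero.1 h1)
      rw [map_apply_toReal, map_apply_toReal] at h2
      -- The outcome ω' has positive mass, lies in the fibre of Y and not in that of (X, Y), so the
      -- two probabilities cannot agree.
      refine absurd h2 (ne_of_gt (Finset.sum_lt_sum (fun η _ => ?_) ⟨ω', Finset.mem_univ _, ?_⟩))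
      · split_ifs with h1 h2
        · exact le_rfl
        · exact absurd (Prod.ext_iff.1 h1).2 h2
        · exact ENNReal.toReal_nonneg
        · exact le_rfl
      · rw [if_neg fun h => hX (Prod.ext_iff.1 h).1, if_pos hY]
        exact hpos ω' hω'
    · intro h ω _
      by_cases hω : ω ∈ p.support
      · rw [mul_eq_zero, sub_eq_zero]
        right
        congr 1
        rw [map_apply_toReal, map_apply_toReal]
        refine Finset.sum_congr rfl fun ω' _ => ?_
        by_cases hω' : ω' ∈ p.support
        · refine if_congr ⟨fun hY => Prod.ext (h ω hω ω' hω' hY) hY, fun e => (Prod.ext_iff.1 e).2⟩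
            rfl rfl
        · rw [PMF.mem_support_iff, not_not] at hω'
          simp [hω']
      · rw [PMF.mem_support_iff, not_not] at hω
        simp [hω]
  · intro ω _
    by_cases hω : ω ∈ p.support
    · exact mul_nonneg ENNReal.toReal_nonneg (sub_nonneg.2 (hlog ω hω))
    · rw [PMF.mem_support_iff, not_not] at hω
      simp [hω]

theorem entropy_uniform [Nonempty Ω] : entropy b (uniform Ω) id = Real.logb b (Nat.card Ω) := by
  let _ := Fintype.ofFinite Ω
  rw [entropy_eq_sum, PMF.map_id]
  simp only [uniform_apply, id, ENNReal.toReal_inv, ENNReal.toReal_natCast, Real.logb_inv, neg_neg,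
    Finset.sum_const, Finset.card_univ, nsmul_eq_mul, Nat.card_eq_fintype_card]
  rw [← mul_assoc, mul_inv_cancel₀ (by simp), one_mul]

theorem entropy_indepProd (p : PMF Ω) (p' : PMF Ω') :
    entropy b (indepProd p p') id = entropy b p id + entropy b p' id := by
  have := entropy_pair_of_indep (b := b) (indepProd p p') Prod.fst Prod.snd p p' (PMF.map_id _)
  rw [show (id : Ω × Ω' → _) = fun ω => (ω.1, ω.2) from rfl, this]
  congr 1
  · exact entropy_congr_law (by rw [indepProd_map_fst, PMF.map_id])
  · exact entropy_congr_law (by rw [indepProd_map_snd, PMF.map_id])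

/-- The logarithm of the product law is a sum over coordinates, and in the i-th summand all other
coordinates integrate to one. -/
theorem entropy_piLaw {ι : Type*} [Fintype ι] (p : PMF Ω) :
    entropy b (piLaw fun _ : ι => p) id = Fintype.card ι * entropy b p id := by
  classical
  let _ := Fintype.ofFinite Ω
  have hsum : ∀ i : ι, ∑ f : ι → Ω, (∏ j, (p (f j)).toReal) * -Real.logb b (p (f i)).toReal =
      entropy b p id := by
    intro i
    have h1 : ∑ a, (p a).toReal = 1 := by
      rw [← ENNReal.toReal_sum fun a _ => p.apply_ne_top a,
        ← tsum_fintype (L := .unconditional _), p.tsum_coe, ENNReal.toReal_one]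
    have h2 : ∀ f : ι → Ω, (∏ j, (p (f j)).toReal) * -Real.logb b (p (f i)).toReal =
        ∏ j, (p (f j)).toReal * (if j = i then -Real.logb b (p (f j)).toReal else 1) := by
      intro f
      rw [Finset.prod_mul_distrib, Finset.prod_ite_eq' Finset.univ i, if_pos (Finset.mem_univ i)]
    rw [Finset.sum_congr rfl fun f _ => h2 f, ← Fintype.piFinset_univ,
      ← Finset.prod_univ_sum (fun _ => Finset.univ) fun j a =>
        (p a).toReal * (if j = i then -Real.logb b (p a).toReal else 1),
      Finset.prod_eq_single i]
    · rw [entropy_eq_sum, PMF.map_id]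
      simp
    · intro j _ hj
      simp [hj, h1]
    · simp
  rw [entropy_eq_sum, PMF.map_id]
  have hterm : ∀ f : ι → Ω, (piLaw (fun _ : ι => p) f).toReal *
      -Real.logb b (piLaw (fun _ : ι => p) (id f)).toReal =
      ∑ i, (∏ j, (p (f j)).toReal) * -Real.logb b (p (f i)).toReal := by
    intro f
    rw [id, piLaw_apply, ENNReal.toReal_prod]
    -- The logarithm of a product splits only for nonzero factors; if a factor vanishes, so does the
    -- common weight on both sides.
    by_cases h : ∃ j, (p (f j)).toReal = 0
    · obtain ⟨j, hj⟩ := h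
      rw [Finset.prod_eq_zero (Finset.mem_univ j) hj]
      simp
    · push Not at h
      rw [Real.logb_prod _ _ fun j _ => h j, ← Finset.sum_neg_distrib, Finset.mul_sum]
  rw [Finset.sum_congr rfl fun f _ => hterm f, Finset.sum_comm,
    Finset.sum_congr rfl fun i _ => hsum i, Finset.sum_const, Finset.card_univ, nsmul_eq_mul]

end Entropy

/-! ### Non-empty sets of parallel messages -/

/-- The nonempty sets of parallel messages: one summand type for each. -/
abbrev SumType (r : ℕ) := {S : Finset (Fin r) // S.Nonempty}

/-- The summand types in which the `τ`-th parallel message occurs. -/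
abbrev Slot {r : ℕ} (τ : Fin r) := {S : SumType r // τ ∈ S.1}

/-- The summand type that only involves the message `τ`. -/
def SumType.single {r : ℕ} (τ : Fin r) : SumType r := ⟨{τ}, singleton_nonempty τ⟩

theorem symmDiff_singleton_nonempty {r : ℕ} {τ : Fin r} {S : Finset (Fin r)} (h : S ≠ {τ}) :
    (symmDiff S {τ}).Nonempty := by
  rw [nonempty_iff_ne_empty]
  exact fun h' => h (symmDiff_eq_bot.1 h')

/-- Adding or removing `τ`; the singleton `{τ}` is fixed. -/
def SumType.toggleFun {r : ℕ} (τ : Fin r) (S : SumType r) : SumType r :=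
  if h : S.1 = {τ} then S else ⟨symmDiff S.1 {τ}, symmDiff_singleton_nonempty h⟩

theorem SumType.toggleFun_single {r : ℕ} (τ : Fin r) :
    toggleFun τ (single τ) = single τ := dif_pos rfl

theorem SumType.toggleFun_of_ne {r : ℕ} {τ : Fin r} {S : SumType r} (h : S ≠ single τ) :
    (toggleFun τ S).1 = symmDiff S.1 {τ} := by
  have h' : S.1 ≠ {τ} := fun h' => h (Subtype.ext h')
  rw [toggleFun, dif_neg h']

theorem SumType.toggleFun_involutive {r : ℕ} (τ : Fin r) :
    Function.Involutive (toggleFun τ) := by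
  intro S
  by_cases h : S = single τ
  · rw [h, toggleFun_single, toggleFun_single]
  · have h1 := toggleFun_of_ne h
    have h2 : toggleFun τ S ≠ single τ := by
      -- S ∆ {τ} = {τ} would force S to be empty.
      intro h2
      rw [h2, single] at h1
      have h3 : symmDiff S.1 {τ} = symmDiff ∅ {τ} := by
        rw [← h1]
        simp [symmDiff]
      exact S.2.ne_empty (symmDiff_left_injective _ h3)
    exact Subtype.ext (by rw [toggleFun_of_ne h2, h1, symmDiff_symmDiff_cancel_right])

/-- `toggleFun` as a permutation. -/
def SumType.toggle {r : ℕ} (τ : Fin r) : Equiv.Perm (SumType r) :=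
  (toggleFun_involutive τ).toPerm

theorem SumType.toggle_toggle {r : ℕ} (τ : Fin r) (S : SumType r) : toggle τ (toggle τ S) = S :=
  toggleFun_involutive τ S

theorem SumType.toggle_symm {r : ℕ} (τ : Fin r) : (toggle τ).symm = toggle τ := rfl

theorem SumType.mem_toggle_of_ne {r : ℕ} {τ τ' : Fin r} (h : τ' ≠ τ) (S : SumType r) :
    τ' ∈ S.1 ↔ τ' ∈ (toggle τ S).1 := by
  change _ ↔ τ' ∈ (toggleFun τ S).1
  by_cases hS : S = single τ
  · rw [hS, toggleFun_single]
  · rw [toggleFun_of_ne hS, mem_symmDiff, mem_singleton]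
    simp [h]

theorem SumType.mem_toggle_self {r : ℕ} {τ : Fin r} {S : SumType r} (h : S ≠ single τ) :
    τ ∈ (toggle τ S).1 ↔ τ ∉ S.1 := by
  change τ ∈ (toggleFun τ S).1 ↔ _
  rw [toggleFun_of_ne h, mem_symmDiff, mem_singleton]
  simp

theorem card_sumType (r : ℕ) : Fintype.card (SumType r) = 2 ^ r - 1 := by
  have h := Fintype.card_subtype_compl (fun S : Finset (Fin r) => S = ∅)
  simp only [← ne_eq, ← nonempty_iff_ne_empty, Fintype.card_finset, Fintype.card_fin,
    Fintype.card_subtype_eq] at h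
  rw [← h]

theorem card_slot {r : ℕ} (τ : Fin r) : Fintype.card (Slot τ) = 2 ^ (r - 1) := by
  have e : Slot τ ≃ {S : Finset (Fin r) // τ ∈ S} :=
    Equiv.subtypeSubtypeEquivSubtype (p := fun S : Finset (Fin r) => S.Nonempty)
      (q := fun S => τ ∈ S) fun h => ⟨τ, h⟩
  rw [Fintype.card_congr e, Fintype.card_subtype]
  have h : (univ.erase τ).powerset.card = 2 ^ (r - 1) := by
    rw [card_powerset, card_erase_of_mem (mem_univ τ), card_univ, Fintype.card_fin]
  rw [← h]
  refine card_nbij' (fun S => S.erase τ) (fun S => insert τ S) ?_ ?_ ?_ ?_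
  · intro S _
    simp
  · intro S _
    simp
  · intro S hS
    exact insert_erase (by simpa using hS)
  · intro S hS
    refine erase_insert fun h => ?_
    have := (mem_powerset.1 hS) h
    simp at this

/-- The permutation of the pieces of the message `τ'` used at the second server if `τ` is wanted:
the wanted message supplies fresh pieces, the others are realigned. -/
def slotTwist {r : ℕ} (τ τ' : Fin r) : Equiv.Perm (Slot τ' × Bool) :=
  if h : τ' = τ then (Equiv.refl _).prodCongr Equiv.boolNot
  else ((SumType.toggle τ).subtypeEquiv fun S => SumType.mem_toggle_of_ne h S).prodCongr
    (Equiv.refl _)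

/-- The pieces of a message: two blocks for each summand type in which it occurs. -/
abbrev MsgSpace (F : Type*) {r : ℕ} (x h : ℕ) (τ : Fin r) := Slot τ × Bool → Fin x → Fin h → F

/-- The masks of an edge: one block for each summand type. -/
abbrev MaskSpace (F : Type*) (r x h : ℕ) := SumType r → Fin x → Fin h → F

/-- The piece of the message `τ` in the summand `S`, zero if it does not occur there. -/
def piece {F : Type*} [Zero F] {r x h : ℕ} {τ : Fin r} (d : MsgSpace F x h τ) (S : SumType r)
    (c : Bool) : Fin x → Fin h → F :=
  if hS : τ ∈ S.1 then d (⟨S, hS⟩, c) else 0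

/-- The storage system in which every message is replaced by `r` parallel ones. -/
def multiStorage {V E : Type*} (ends : E → Sym2 V) (r : ℕ) : E × Fin r → Sym2 V :=
  fun e => ends e.1

/-- A retrieval code whose interference is aligned: server `v` encodes one block of `h` symbols for
each of its messages; for the interfering messages the blocks at the two servers are tied by
`align`, and the two blocks of the wanted message can be decoded from all answers. -/
structure AlignedCode (F : Type*) [AddCommGroup F] {V E : Type*} (ends : E → Sym2 V) where
  /-- the first server of a message -/
  base : E → V
  /-- the second server of a message -/
  other : E → V
  other_ne : ∀ e, other e ≠ base e
  /-- the block length -/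
  h : ℕ
  h_pos : 0 < h
  U : Type
  finite_U : Finite U
  userLaw : PMF U
  Query : V → Type
  query : E → (v : V) → U → Query v
  len : V → ℕ
  code : (v : V) → Query v → ({e : E // v ∈ ends e} → Fin h → F) → Fin (len v) → F
  align : E → U → E → (Fin h → F) ≃+ (Fin h → F)
  map_query : ∀ v k k', userLaw.map (query k v) = userLaw.map (query k' v)
  decodes : ∀ k, ∀ u ∈ userLaw.support, ∀ z z' : E → V → Fin h → F,
    (∀ e, e ≠ k → z e (other e) = align k u e (z e (base e))) →
    (∀ e, e ≠ k → z' e (other e) = align k u e (z' e (base e))) →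
    (∀ v, code v (query k v u) (fun e => z e.1 v) = code v (query k v u) (fun e => z' e.1 v)) →
    z k (base k) = z' k (base k) ∧ z k (other k) = z' k (other k)

/-! ### From an aligned code to a symmetric scheme -/

namespace AlignedCode

variable {F : Type*} [Field F] {V E : Type*} {ends : E → Sym2 V}

/-- The law of the answer of server `v` when `k` is wanted and all blocks are uniform. -/
def answerLaw [Finite F] [Finite E] (C : AlignedCode F ends) (k : E) (v : V) : PMF (Fin (C.len v) → F) :=
  C.userLaw.bind fun u =>
    (uniform ({e : E // v ∈ ends e} → Fin C.h → F)).map (C.code v (C.query k v u))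

/-- The part of the user's randomness that hides the wanted message: a random description of every
message and of every mask, and a random query for the retrieval of masks. -/
abbrev Key (F : Type*) (E : Type*) (r x y h L : ℕ) :=
  ((θ : E × Fin r) → (Fin L → F) ≃ MsgSpace F x h θ.2) × (E → Equiv.Perm (MaskSpace F r x h)) ×
    ((E → MaskSpace F r x h) → Fin y → F)

/-- The masked sums of parallel messages of the edge `e`. -/
def mix {r x y h L : ℕ} (g : Key F E r x y h L) (e : E) (m : Fin r → Fin L → F)
    (s : MaskSpace F r x h) : MaskSpace F r x h :=
  fun S => ∑ τ, piece (g.1 (e, τ) (m τ)) S false + g.2.1 e s S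

variable (C : AlignedCode F ends) {r x y L : ℕ}

open Classical in
/-- How the description of the message `θ'` at server `v` deviates from the key if `θ` is wanted. -/
def msgTwist (θ : E × Fin r) (u : SumType r × Fin x → C.U) (v : V) (θ' : E × Fin r) :
    Equiv.Perm (MsgSpace F x C.h θ'.2) :=
  if v = C.base θ'.1 then Equiv.refl _
  else if θ'.1 = θ.1 then (slotTwist θ.2 θ'.2).arrowCongr (Equiv.refl _)
  else Equiv.piCongrRight fun a => Equiv.piCongrRight fun i =>
    (C.align θ.1 (u (a.1.1, i)) θ'.1).toEquiv

open Classical in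
/-- How the description of the masks at server `v` deviates from the key if `θ` is wanted. -/
def maskTwist (θ : E × Fin r) (u : SumType r × Fin x → C.U) (v : V) (e : E) :
    Equiv.Perm (MaskSpace F r x C.h) :=
  if v = C.base e then Equiv.refl _
  else if e = θ.1 then (SumType.toggle θ.2).arrowCongr (Equiv.refl _)
  else Equiv.piCongrRight fun S => Equiv.piCongrRight fun i =>
    (C.align θ.1 (u (S, i)) e).toEquiv

open Classical in
/-- The part of the block `a` that is retrieved from server `v`. -/
def share {h : ℕ} {v₀ : V} (split : Fin x × Fin h ≃ {v : V // v ≠ v₀} × Fin y) (v : V)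
    (a : Fin x → Fin h → F) : Fin y → F :=
  if hv : v = v₀ then 0
  else fun j => a (split.symm (⟨v, hv⟩, j)).1 (split.symm (⟨v, hv⟩, j)).2

/-- The description sent to server `v` if `θ` is wanted. -/
def twist {v₀ : V} (split : Fin x × Fin C.h ≃ {v : V // v ≠ v₀} × Fin y) (θ : E × Fin r)
    (u : SumType r × Fin x → C.U) (v : V) (g : Key F E r x y C.h L) : Key F E r x y C.h L :=
  (fun θ' => (g.1 θ').trans (C.msgTwist θ u v θ'), fun e => (g.2.1 e).trans (C.maskTwist θ u v e),
    -- The shift uses the untwisted mask permutation, so all servers receive shares of one and the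
    -- same mask.
    fun s => g.2.2 s + share split v (g.2.1 θ.1 (s θ.1) (.single θ.2)))

/-- The bijections are composed with fixed permutations; once they are recovered, the translation of
the random function is known too. On a finite set of keys this makes the twisted key uniform for
every wanted message and every choice of queries. -/
theorem twist_injective {v₀ : V} (split : Fin x × Fin C.h ≃ {v : V // v ≠ v₀} × Fin y)
    (θ : E × Fin r) (u : SumType r × Fin x → C.U) (v : V) :
    Function.Injective (C.twist (L := L) split θ u v) := by
  rintro ⟨m, γ, f⟩ ⟨m', γ', f'⟩ h
  simp only [twist, Prod.mk.injEq] at h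
  obtain ⟨h1, h2, h3⟩ := h
  have hm : m = m' := by
    funext θ'
    have := congrFun h1 θ'
    exact Equiv.ext fun a => (C.msgTwist θ u v θ').injective (Equiv.congr_fun this a)
  have hγ : γ = γ' := by
    funext e
    have := congrFun h2 e
    exact Equiv.ext fun a => (C.maskTwist θ u v e).injective (Equiv.congr_fun this a)
  subst hm hγ
  have hf : f = f' := by
    funext s
    exact add_right_cancel (congrFun h3 s)
  rw [hf]

open Classical in
/-- The blocks that server `v` encodes, in terms of the blocks `z` of the first servers and of the
pieces `d` of the wanted message `θ`. -/
def view (θ : E × Fin r) (u : SumType r × Fin x → C.U) (v : V) (d : MsgSpace F x C.h θ.2)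
    (z : E → MaskSpace F r x C.h) (e : E) : MaskSpace F r x C.h :=
  if v = C.base e then z e
  else if e = θ.1 then fun S => z e (SumType.toggle θ.2 S) -
      piece d (SumType.toggle θ.2 S) false + piece d S true
    else fun S i => C.align θ.1 (u (S, i)) e (z e S i)

theorem piece_slotTwist_self {h : ℕ} (τ : Fin r) (d : MsgSpace F x h τ) (S : SumType r) :
    piece ((slotTwist τ τ).arrowCongr (Equiv.refl _) d) S false = piece d S true := by
  unfold piece
  split_ifs with hS
  · simp [slotTwist, Equiv.arrowCongr]
  · rfl

theorem piece_slotTwist_of_ne {h : ℕ} {τ τ' : Fin r} (hτ : τ' ≠ τ) (d : MsgSpace F x h τ')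
    (S : SumType r) (c : Bool) :
    piece ((slotTwist τ τ').arrowCongr (Equiv.refl _) d) S c =
      piece d (SumType.toggle τ S) c := by
  unfold piece
  by_cases hS : τ' ∈ S.1
  · rw [dif_pos hS, dif_pos ((SumType.mem_toggle_of_ne hτ S).1 hS)]
    simp only [slotTwist, dif_neg hτ, Equiv.arrowCongr_apply, Equiv.coe_refl, Function.comp_apply,
      id]
    rfl
  · rw [dif_neg hS, dif_neg fun h => hS ((SumType.mem_toggle_of_ne hτ S).2 h)]

/-- Interference alignment: through the twisted keys all servers see functions of the first servers'
blocks and of the wanted pieces only. On the wanted edge, toggling carries masks and unwanted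
parallel pieces along together; on other edges the alignment is additive and passes through the
masked sum. -/
theorem mix_twist {v₀ : V} (split : Fin x × Fin C.h ≃ {v : V // v ≠ v₀} × Fin y)
    (θ : E × Fin r) (u : SumType r × Fin x → C.U) (v : V) (g : Key F E r x y C.h L)
    (w : E × Fin r → Fin L → F) (s : E → MaskSpace F r x C.h) (e : E) :
    mix (C.twist split θ u v g) e (fun τ => w (e, τ)) (s e) =
      C.view θ u v (g.1 θ (w θ)) (fun e => mix g e (fun τ => w (e, τ)) (s e)) e := by
  classical
  obtain ⟨k, τ⟩ := θ
  by_cases hv : v = C.base e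
  · funext S
    simp only [mix, twist, view, msgTwist, maskTwist, if_pos hv, Equiv.trans_apply,
      Equiv.refl_apply]
  by_cases he : e = k
  · subst he
    funext S
    simp only [mix, twist, view, msgTwist, maskTwist, hv, if_false, if_true, Equiv.trans_apply]
    -- The wanted term is split off both sums: it becomes the fresh piece on one side and cancels on
    -- the other, and the remaining terms match after toggling.
    rw [← Finset.add_sum_erase univ _ (mem_univ τ), ← Finset.add_sum_erase univ _ (mem_univ τ),
      piece_slotTwist_self, Finset.sum_congr rfl fun τ' hτ' =>
        piece_slotTwist_of_ne (ne_of_mem_erase hτ') (g.1 (e, τ') (w (e, τ'))) S false]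
    simp only [Equiv.arrowCongr_apply, Equiv.coe_refl, Function.comp_apply, id,
      SumType.toggle_symm]
    abel
  · funext S i
    simp only [mix, twist, view, msgTwist, maskTwist, hv, he, if_false, Equiv.trans_apply]
    rw [Pi.add_apply, Pi.add_apply, Finset.sum_apply, Finset.sum_apply, map_add, map_sum]
    congr 1
    refine Finset.sum_congr rfl fun τ' _ => ?_
    unfold piece
    split_ifs with hS
    · rfl
    · simp

/-- Masks and noise can be exchanged. -/
theorem mask_injective {h : ℕ} (g : Key F E r x y h L) (w : E × Fin r → Fin L → F) :
    Function.Injective fun c : (E → MaskSpace F r x h) × (Fin y → F) =>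
      ((fun e => mix g e (fun τ => w (e, τ)) (c.1 e), c.2 + g.2.2 c.1) :
        (E → MaskSpace F r x h) × (Fin y → F)) := by
  rintro ⟨s, t⟩ ⟨s', t'⟩ hc
  obtain ⟨h1, h2⟩ := Prod.ext_iff.1 hc
  have hs : s = s' := by
    funext e
    refine (g.2.1 e).injective (funext fun S => ?_)
    exact add_left_cancel (congrFun (congrFun h1 e) S)
  subst hs
  exact Prod.ext rfl (add_right_cancel h2)

end AlignedCode

theorem card_msgSpace {F : Type*} [Finite F] {r x h : ℕ} (τ : Fin r) :
    Nat.card (MsgSpace F x h τ) = Nat.card (Fin (2 ^ (r - 1) * (2 * h) * x) → F) := by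
  simp only [Nat.card_fun, Nat.card_eq_fintype_card, Fintype.card_prod, card_slot, Fintype.card_bool,
    Fintype.card_fin, ← pow_mul]
  congr 1
  ring

namespace AlignedCode

variable {F : Type*} [Field F] [Finite F] {V E : Type*} [Finite E] {ends : E → Sym2 V}
  (C : AlignedCode F ends) {r x y : ℕ}

instance (r x y h L : ℕ) : Finite (Key F E r x y h L) := by
  have (θ : E × Fin r) : Finite ((Fin L → F) ≃ MsgSpace F x h θ.2) :=
    Finite.of_injective _ DFunLike.coe_injective
  infer_instance

instance (r x y h : ℕ) : Nonempty (Key F E r x y h (2 ^ (r - 1) * (2 * h) * x)) :=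
  ⟨fun θ => (Finite.card_eq.1 (card_msgSpace (F := F) (x := x) (h := h) θ.2)).some.symm,
    fun _ => Equiv.refl _, 0⟩

instance (r x y h : ℕ) :
    Nonempty (Shrink.{0} (Key F E r x y h (2 ^ (r - 1) * (2 * h) * x))) :=
  (equivShrink.{0} _).symm.nonempty

instance (r x y h : ℕ) : Nonempty (Shrink.{0} ((E → MaskSpace F r x h) × (Fin y → F))) :=
  (equivShrink.{0} _).symm.nonempty

instance : Finite C.U := C.finite_U

/-- The arrangement of the answer symbols of server `v`. -/
def symbolEquiv (r x y : ℕ) (v : V) :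
    Fin ((2 ^ r - 1) * C.len v * x + y) ≃ ((SumType r × Fin x) × Fin (C.len v)) ⊕ Fin y :=
  Fintype.equivOfCardEq (by
    simp only [Fintype.card_sum, Fintype.card_prod, Fintype.card_fin, card_sumType]
    ring)

/-- The answer of a server as the pair of its encoded blocks and its share of the masks. -/
def assemble (v : V) (a : (SumType r × Fin x → Fin (C.len v) → F) × (Fin y → F)) :
    Fin ((2 ^ r - 1) * C.len v * x + y) → F :=
  fun n => Sum.elim (fun i => a.1 i.1 i.2) a.2 (C.symbolEquiv r x y v n)

omit [Finite F] [Finite E] in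
theorem assemble_injective (v : V) : Function.Injective (C.assemble (r := r) (x := x) (y := y) v) := by
  intro a a' h
  have h' : ∀ i, Sum.elim (fun i : (SumType r × Fin x) × Fin (C.len v) => a.1 i.1 i.2) a.2 i =
      Sum.elim (fun i => a'.1 i.1 i.2) a'.2 i := by
    intro i
    have := congrFun h ((C.symbolEquiv r x y v).symm i)
    simpa only [assemble, Equiv.apply_symm_apply] using this
  exact Prod.ext (funext fun ρ => funext fun n => h' (.inl (ρ, n))) (funext fun j => h' (.inr j))

/-- The encoded blocks of server `v`. -/
def blocks (v : V) (q : SumType r × Fin x → C.Query v)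
    (z : {e : E // v ∈ ends e} → MaskSpace F r x C.h) (ρ : SumType r × Fin x) :
    Fin (C.len v) → F :=
  C.code v (q ρ) fun e => z e ρ.1 ρ.2

/-- The symmetric retrieval protocol obtained from an aligned code: `x` copies of the code for every
nonempty set of parallel messages, all blocks being masked, together with the symmetric retrieval
of the masks of the summand that only involves the wanted message. -/
def toProtocol {v₀ : V} (hx : 0 < x)
    (split : Fin x × Fin C.h ≃ {v : V // v ≠ v₀} × Fin y) : Protocol F (multiStorage ends r) where
  L := 2 ^ (r - 1) * (2 * C.h) * x
  L_pos := by have := C.h_pos; positivity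
  -- The field and the graph may live in any universe, whereas the randomness and queries of a
  -- protocol lie in `Type`; `Shrink.{0}` supplies copies there of the finite types.
  U := (SumType r × Fin x → C.U) × Shrink.{0} (Key F E r x y C.h (2 ^ (r - 1) * (2 * C.h) * x))
  finite_U := inferInstance
  userLaw := indepProd (piLaw fun _ => C.userLaw) (uniform _)
  R := Shrink.{0} ((E → MaskSpace F r x C.h) × (Fin y → F))
  finite_R := inferInstance
  randLaw := uniform _
  Query v := (SumType r × Fin x → C.Query v) ×
    Shrink.{0} (Key F E r x y C.h (2 ^ (r - 1) * (2 * C.h) * x))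
  query θ v u := (fun ρ => C.query θ.1 v (u.1 ρ),
    equivShrink.{0} _ (C.twist split θ u.1 v ((equivShrink.{0} _).symm u.2)))
  len v := (2 ^ r - 1) * C.len v * x + y
  answer v q w c :=
    let g := (equivShrink.{0} _).symm q.2
    let s := (equivShrink.{0} _).symm c
    C.assemble v
      (C.blocks v q.1 fun e => mix g e.1 (fun τ => w ⟨(e.1, τ), e.2⟩) (s.1 e.1), s.2 + g.2.2 s.1)

section

variable {v₀ : V} (hx : 0 < x) (split : Fin x × Fin C.h ≃ {v : V // v ≠ v₀} × Fin y)

omit [Field F] [Finite F] [Finite E] in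
theorem indepProd_map_shrink {α κ κ' γ ξ ξ' β : Type*} [Finite κ] [Nonempty κ] [Finite κ']
    [Nonempty κ'] [Finite ξ] [Nonempty ξ] [Finite ξ'] [Nonempty ξ'] (e : κ ≃ κ') (e' : ξ ≃ ξ')
    (p : PMF α) (q : PMF γ) (f : (α × κ') × γ × ξ' → β) :
    (indepProd (indepProd p (uniform κ')) (indepProd q (uniform ξ'))).map f =
      p.bind fun u => (uniform κ).bind fun g => q.bind fun w => (uniform ξ).map fun c =>
        f ((u, e g), w, e' c) := by
  rw [indepProd_map, indepProd_bind]
  simp only [indepProd_map, ← uniform_map_equiv e, ← uniform_map_equiv e', PMF.bind_map,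
    PMF.map_comp, Function.comp_def]

theorem toProtocol_law_map {β : Type*} (f : (C.toProtocol (r := r) hx split).U ×
    (E × Fin r → Fin (C.toProtocol (r := r) hx split).L → F) ×
      (C.toProtocol (r := r) hx split).R → β) :
    (C.toProtocol (r := r) hx split).law.map f =
      (piLaw fun _ => C.userLaw).bind fun u =>
        (uniform (Key F E r x y C.h (2 ^ (r - 1) * (2 * C.h) * x))).bind fun g =>
          (uniform (E × Fin r → Fin (2 ^ (r - 1) * (2 * C.h) * x) → F)).bind fun w =>
            (uniform ((E → MaskSpace F r x C.h) × (Fin y → F))).map fun c =>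
              f ((u, equivShrink.{0} _ g), w, equivShrink.{0} _ c) :=
  indepProd_map_shrink (equivShrink.{0} _) (equivShrink.{0} _) _ _ f

/-- The blocks of the first servers and the share of the first server. -/
def noise {L : ℕ} (g : Key F E r x y C.h L) (w : E × Fin r → Fin L → F)
    (c : (E → MaskSpace F r x C.h) × (Fin y → F)) : (E → MaskSpace F r x C.h) × (Fin y → F) :=
  (fun e => mix g e (fun τ => w (e, τ)) (c.1 e), c.2 + g.2.2 c.1)

/-- The answer of server `v` as a function of the key, the queries, the pieces of the wanted message
and the noise. -/
def answerOf (θ : E × Fin r) (u : SumType r × Fin x → C.U) (v : V) (d : MsgSpace F x C.h θ.2)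
    (n : (E → MaskSpace F r x C.h) × (Fin y → F)) : Fin ((2 ^ r - 1) * C.len v * x + y) → F :=
  C.assemble v (C.blocks v (fun ρ => C.query θ.1 v (u ρ)) fun e => C.view θ u v d n.1 e.1,
    n.2 + share split v (n.1 θ.1 (.single θ.2) - piece d (.single θ.2) false))

-- Only τ occurs in the summand {τ}, so its mask is the block minus one wanted piece. This expresses
-- the retrieved share through the noise and the wanted pieces.
omit [Finite F] [Finite E] in
theorem mask_single {L : ℕ} (g : Key F E r x y C.h L) (e : E) (τ : Fin r) (m : Fin r → Fin L → F)
    (s : MaskSpace F r x C.h) :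
    g.2.1 e s (.single τ) =
      mix g e m s (.single τ) - piece (g.1 (e, τ) (m τ)) (.single τ) false := by
  rw [mix, Finset.sum_eq_single τ, add_sub_cancel_left]
  · intro τ' _ hτ'
    exact dif_neg (by simpa [SumType.single] using hτ')
  · simp

/-- The joint view: the noise is that of the common untwisted key, hence the same for all servers.
Reliability and database privacy rest on this form. -/
theorem ans_eq (θ : E × Fin r) (v : V) (u : SumType r × Fin x → C.U)
    (g : Key F E r x y C.h (2 ^ (r - 1) * (2 * C.h) * x))
    (w : E × Fin r → Fin (2 ^ (r - 1) * (2 * C.h) * x) → F)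
    (c : (E → MaskSpace F r x C.h) × (Fin y → F)) :
    (C.toProtocol hx split).ans θ v ((u, equivShrink.{0} _ g), w, equivShrink.{0} _ c) =
      C.answerOf split θ u v (g.1 θ (w θ)) (C.noise g w c) := by
  simp only [Protocol.ans, toProtocol, answerOf, noise, Equiv.symm_apply_apply, storedPart]
  refine congrArg (C.assemble v) (Prod.ext (congrArg (C.blocks v _) (funext fun e => ?_)) ?_)
  · exact C.mix_twist split θ u v g w c.1 e.1
  · rw [← C.mask_single g θ.1 θ.2 (fun τ => w (θ.1, τ)) (c.1 θ.1)]
    simp only [twist, add_assoc]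

/-- The view of a single server, with the noise read through its own twisted key. This form serves
to compute the law of one answer. -/
theorem ans_eq_noise (θ : E × Fin r) (v : V) (u : SumType r × Fin x → C.U)
    (g : Key F E r x y C.h (2 ^ (r - 1) * (2 * C.h) * x))
    (w : E × Fin r → Fin (2 ^ (r - 1) * (2 * C.h) * x) → F)
    (c : (E → MaskSpace F r x C.h) × (Fin y → F)) :
    (C.toProtocol hx split).ans θ v ((u, equivShrink.{0} _ g), w, equivShrink.{0} _ c) =
      C.assemble v (C.blocks v (fun ρ => C.query θ.1 v (u ρ))
        fun e => (C.noise (C.twist split θ u v g) w c).1 e.1,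
          (C.noise (C.twist split θ u v g) w c).2) := by
  simp only [Protocol.ans, toProtocol, noise, Equiv.symm_apply_apply, storedPart]

theorem uniform_map_noise {L : ℕ} (g : Key F E r x y C.h L) (w : E × Fin r → Fin L → F) :
    (uniform _).map (C.noise g w) = uniform _ :=
  uniform_map_injective (mask_injective g w)

/-- An answer is a function of query and content, so it suffices to compare the laws of these. The
key part of the query is uniform and independent of the code queries by `twist_injective`, and the
code queries are independent copies whose law is that of the code. -/
theorem userPrivacy_toProtocol : (C.toProtocol (r := r) hx split).UserPrivacy := by
  intro v θ θ'
  have hlaw : ∀ θ : E × Fin r, (C.toProtocol (r := r) hx split).law.map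
      (fun ω => ((C.toProtocol hx split).query θ v ω.1, ω.2)) =
      indepProd (indepProd ((piLaw fun _ : SumType r × Fin x => C.userLaw).map
        fun u ρ => C.query θ.1 v (u ρ)) (uniform _))
        (C.toProtocol hx split).contentLaw := by
    intro θ
    refine (indepProd_map_map _ _ _ id).trans ?_
    rw [PMF.map_id]
    congr 1
    refine (indepProd_map _ _ _).trans ?_
    rw [indepProd, PMF.bind_map]
    congr 1
    funext u
    have h : (uniform _).map (fun a => equivShrink.{0} (Key F E r x y C.h (2 ^ (r - 1) * (2 * C.h) * x))
        (C.twist split θ u v ((equivShrink.{0} _).symm a))) = uniform _ :=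
      uniform_map_injective ((equivShrink.{0} _).injective.comp
        ((C.twist_injective split θ u v).comp (equivShrink.{0} _).symm.injective))
    conv_rhs => rw [← h]
    simp only [Function.comp_apply, PMF.map_comp]
    rfl
  have hq : ∀ θ θ' : E × Fin r, (piLaw fun _ : SumType r × Fin x => C.userLaw).map
      (fun u ρ => C.query θ.1 v (u ρ)) = (piLaw fun _ : SumType r × Fin x => C.userLaw).map
      (fun u ρ => C.query θ'.1 v (u ρ)) := by
    intro θ θ'
    ext f
    rw [piLaw_map_apply _ fun _ => C.query θ.1 v, piLaw_map_apply _ fun _ => C.query θ'.1 v]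
    simp only [C.map_query v θ.1 θ'.1]
  have key := (hlaw θ).trans ((congrArg (fun p => indepProd (indepProd p _) _) (hq θ θ')).trans
    (hlaw θ').symm)
  have := congrArg (PMF.map fun a => (a.1, (C.toProtocol (r := r) hx split).answer v a.1
    (storedPart _ v a.2.1) a.2.2, storedPart (multiStorage ends r) v a.2.1, a.2.2)) key
  rw [PMF.map_comp, PMF.map_comp] at this
  exact this

omit [Finite F] [Finite E] in
theorem share_injective {h : ℕ} {v₀ : V} (split : Fin x × Fin h ≃ {v : V // v ≠ v₀} × Fin y)
    {a a' : Fin x → Fin h → F} (H : ∀ v, share split v a = share split v a') : a = a' := by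
  funext i j
  have := congrFun (H (split (i, j)).1.1) (split (i, j)).2
  rw [share, share, dif_neg (split (i, j)).1.2, dif_neg (split (i, j)).1.2] at this
  simpa using this

omit [Finite F] [Finite E] in
/-- The answers determine the pieces of the wanted message. -/
theorem answerOf_determines {θ : E × Fin r} {u : SumType r × Fin x → C.U}
    (hu : ∀ ρ, u ρ ∈ C.userLaw.support) {d d' : MsgSpace F x C.h θ.2}
    {n n' : (E → MaskSpace F r x C.h) × (Fin y → F)}
    (H : ∀ v, C.answerOf split θ u v d n = C.answerOf split θ u v d' n') : d = d' := by
  obtain ⟨k, τ⟩ := θ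
  have H' := fun v => Prod.ext_iff.1 (C.assemble_injective v (H v))
  have hdec : ∀ S i, n.1 k S i = n'.1 k S i ∧
      (n.1 k (SumType.toggle τ S) - piece d (SumType.toggle τ S) false + piece d S true) i =
      (n'.1 k (SumType.toggle τ S) - piece d' (SumType.toggle τ S) false + piece d' S true) i := by
    -- The views of the unwanted edges are tied by the alignment by construction, so copy (S, i) of
    -- the code reveals both blocks of the edge k.
    intro S i
    have h := C.decodes k (u (S, i)) (hu _)
      (fun e v => C.view (k, τ) u v d n.1 e S i) (fun e v => C.view (k, τ) u v d' n'.1 e S i)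
      (fun e he => by simp only [view, if_true, if_neg (C.other_ne e), if_neg he])
      (fun e he => by simp only [view, if_true, if_neg (C.other_ne e), if_neg he])
      (fun v => congrFun (H' v).1 (S, i))
    simpa only [view, if_true, if_neg (C.other_ne k)] using h
  have hn : n.1 k = n'.1 k := funext fun S => funext fun i => (hdec S i).1
  -- Server v₀ holds no share and returns the bare noise, which is subtracted from the other answers
  -- to obtain the shares.
  have h2 : n.2 = n'.2 := by
    have := (H' v₀).2
    simpa only [share, dif_pos, add_zero] using this
  have hs : piece d (.single τ) false = piece d' (.single τ) false := by
    have := share_injective split fun v => add_left_cancel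
      (show n.2 + _ = n.2 + _ from (H' v).2.trans (by rw [h2]))
    simp only [hn] at this
    exact sub_right_injective this
  have hrel : ∀ S, -piece d (SumType.toggle τ S) false + piece d S true =
      -piece d' (SumType.toggle τ S) false + piece d' S true := by
    intro S
    have h : n.1 k (SumType.toggle τ S) - piece d (SumType.toggle τ S) false + piece d S true =
        n'.1 k (SumType.toggle τ S) - piece d' (SumType.toggle τ S) false + piece d' S true :=
      funext fun i => (hdec S i).2
    rw [hn, sub_eq_add_neg, sub_eq_add_neg, add_assoc, add_assoc] at h
    exact add_left_cancel h
  -- For S = {τ} the retrieved mask decides. For a larger S containing τ, the relation is read at S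
  -- ∆ {τ}, where the message τ has no fresh piece.
  have hfalse : ∀ S, piece d S false = piece d' S false := by
    intro S
    by_cases h1 : S = .single τ
    · rw [h1, hs]
    by_cases h2 : τ ∈ S.1
    · have h3 : τ ∉ (SumType.toggle τ S).1 := fun h => (SumType.mem_toggle_self h1).1 h h2
      have h4 := hrel (SumType.toggle τ S)
      rw [SumType.toggle_toggle] at h4
      have h5 : ∀ d : MsgSpace F x C.h τ, piece d (SumType.toggle τ S) true = 0 :=
        fun d => dif_neg h3
      rw [h5, h5, add_zero, add_zero] at h4
      exact neg_injective h4
    · have h3 : ∀ d : MsgSpace F x C.h τ, piece d S false = 0 := fun d => dif_neg h2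
      rw [h3, h3]
  have htrue : ∀ S, piece d S true = piece d' S true := by
    intro S
    have := hrel S
    rw [hfalse] at this
    exact add_left_cancel this
  funext ⟨⟨S, hS⟩, c⟩
  have h : piece d S c = piece d' S c := by
    cases c
    · exact hfalse S
    · exact htrue S
  simpa only [piece, dif_pos hS] using h

theorem mem_support_toProtocol {ω : (C.toProtocol (r := r) hx split).U ×
    (E × Fin r → Fin (C.toProtocol (r := r) hx split).L → F) × (C.toProtocol (r := r) hx split).R}
    (hω : ω ∈ (C.toProtocol (r := r) hx split).law.support) (ρ : SumType r × Fin x) :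
    ω.1.1 ρ ∈ C.userLaw.support :=
  (mem_support_piLaw (fun _ => C.userLaw) ω.1.1).1
    ((mem_support_indepProd _ _ _).1 ((mem_support_indepProd _ _ _).1 hω).1).1 ρ

instance finite_toProtocol : Finite ((C.toProtocol (r := r) hx split).U ×
    (E × Fin r → Fin (C.toProtocol (r := r) hx split).L → F) ×
      (C.toProtocol (r := r) hx split).R) := by
  have := (C.toProtocol (r := r) hx split).finite_U
  have := (C.toProtocol (r := r) hx split).finite_R
  infer_instance

theorem ans_eq_answerOf (θ : E × Fin r) (v : V) (ω : (C.toProtocol (r := r) hx split).U ×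
    (E × Fin r → Fin (C.toProtocol (r := r) hx split).L → F) ×
      (C.toProtocol (r := r) hx split).R) :
    (C.toProtocol hx split).ans θ v ω =
      C.answerOf split θ ω.1.1 v (((equivShrink.{0} _).symm ω.1.2).1 θ (ω.2.1 θ))
        (C.noise ((equivShrink.{0} _).symm ω.1.2) ω.2.1 ((equivShrink.{0} _).symm ω.2.2)) := by
  obtain ⟨⟨u, κ⟩, w, c⟩ := ω
  obtain ⟨g, rfl⟩ := (equivShrink.{0} _).surjective κ
  obtain ⟨c, rfl⟩ := (equivShrink.{0} _).surjective c
  refine (C.ans_eq hx split θ v u g w c).trans ?_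
  simp only [Equiv.symm_apply_apply]
  rfl

theorem reliable_toProtocol : (C.toProtocol (r := r) hx split).Reliable := by
  intro θ
  rw [condEntropy_eq_zero_iff Finite.one_lt_card]
  intro ω hω ω' _ h
  obtain ⟨hA, hU⟩ := Prod.ext_iff.1 h
  have hA' : ∀ v, (C.toProtocol hx split).ans θ v ω = (C.toProtocol hx split).ans θ v ω' :=
    fun v => congrFun hA v
  obtain ⟨U, w, c⟩ := ω
  obtain ⟨U', w', c'⟩ := ω'
  obtain rfl : U = U' := hU
  simp only [ans_eq_answerOf] at hA'
  exact (((equivShrink.{0} _).symm U.2).1 θ).injective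
    (C.answerOf_determines split (C.mem_support_toProtocol hx split hω) hA')

omit [Finite F] [Finite E] in
theorem uniform_map_coordinate {ι α : Type*} [Finite ι] [Finite α] [Nonempty α] (i : ι) :
    (uniform (ι → α)).map (fun f => ((fun j : {j // j ≠ i} => f j.1), f i)) =
      indepProd (uniform ({j // j ≠ i} → α)) (uniform α) := by
  classical
  rw [← uniform_prod]
  exact uniform_map_equiv ((Equiv.funSplitAt i α).trans (Equiv.prodComm _ _))

/-- For fixed user randomness and messages the noise is uniform, and apart from it the answers
involve only the wanted message. Hence the other messages are independent of everything the user
sees. -/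
theorem databasePrivacy_toProtocol : (C.toProtocol (r := r) hx split).DatabasePrivacy := by
  intro θ
  let Y : (SumType r × Fin x → C.U) → Key F E r x y C.h (2 ^ (r - 1) * (2 * C.h) * x) →
      (Fin (2 ^ (r - 1) * (2 * C.h) * x) → F) → (E → MaskSpace F r x C.h) × (Fin y → F) →
      ((v : V) → Fin ((C.toProtocol (r := r) hx split).len v) → F) ×
        ((v : V) → (C.toProtocol (r := r) hx split).Query v) × (C.toProtocol (r := r) hx split).U :=
    fun u g m n => (fun v => C.answerOf split θ u v (g.1 θ m) n,
      fun v => (C.toProtocol hx split).query θ v (u, equivShrink.{0} _ g), (u, equivShrink.{0} _ g))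
  refine mutualInfo_eq_zero_of_indep _ _ _ (uniform ({e : E × Fin r // e ≠ θ} → _))
    ((piLaw fun _ => C.userLaw).bind fun u => (uniform _).bind fun g => (uniform _).bind fun m =>
      (uniform _).map fun n => Y u g m n) ?_
  rw [toProtocol_law_map]
  simp only [ans_eq]
  have h1 : ∀ u g w, (uniform ((E → MaskSpace F r x C.h) × (Fin y → F))).map (fun c =>
      ((fun e : {e : E × Fin r // e ≠ θ} => w e.1), Y u g (w θ) (C.noise g w c))) =
      (uniform _).map fun n => ((fun e : {e : E × Fin r // e ≠ θ} => w e.1), Y u g (w θ) n) := by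
    intro u g w
    conv_rhs => rw [← C.uniform_map_noise g w]
    rw [PMF.map_comp]
    rfl
  refine (congrArg _ (funext fun u => congrArg _ (funext fun g => congrArg _ (funext fun w =>
    h1 u g w)))).trans ?_
  have h2 : ∀ u g, ((uniform (E × Fin r → Fin (2 ^ (r - 1) * (2 * C.h) * x) → F)).bind fun w =>
      (uniform _).map fun n => ((fun e : {e : E × Fin r // e ≠ θ} => w e.1), Y u g (w θ) n)) =
      (uniform _).bind fun a => (uniform _).bind fun m => (uniform _).map fun n =>
        (a, Y u g m n) := by
    intro u g
    have := congrArg (fun p => PMF.bind p fun am => (uniform _).map fun n => (am.1, Y u g am.2 n))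
      (uniform_map_coordinate (α := Fin (2 ^ (r - 1) * (2 * C.h) * x) → F) θ)
    simp only [PMF.bind_map, indepProd_bind] at this
    exact this
  refine (congrArg _ (funext fun u => congrArg _ (funext fun g => h2 u g))).trans ?_
  simp only [indepProd, PMF.map_bind, PMF.map_comp]
  -- The draw of the unwanted messages is moved past the code queries and then past the key.
  rw [PMF.bind_comm (uniform _) (piLaw _)]
  refine congrArg _ (funext fun u => ?_)
  rw [PMF.bind_comm (uniform _) (uniform _)]
  rfl

/-- For fixed user randomness and messages the blocks at a server are uniform and independent.
Averaging over the user's randomness leaves (2^r - 1)x independent copies of the code's answer and y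
independent uniform symbols. -/
theorem entropy_ans (θ : E × Fin r) (v : V) :
    entropy (Nat.card F) (C.toProtocol (r := r) hx split).law ((C.toProtocol hx split).ans θ v) =
      (2 ^ r - 1) * entropy (Nat.card F) (C.answerLaw θ.1 v) id * x + y := by
  have hq : (1 : ℝ) < Nat.card F := by exact_mod_cast Finite.one_lt_card
  have hlaw : (C.toProtocol (r := r) hx split).law.map ((C.toProtocol hx split).ans θ v) =
      (indepProd (piLaw fun _ : SumType r × Fin x => C.answerLaw θ.1 v)
        (uniform (Fin y → F))).map (C.assemble v) := by
    rw [toProtocol_law_map]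
    simp only [ans_eq_noise]
    have h1 : ∀ u (g : Key F E r x y C.h (2 ^ (r - 1) * (2 * C.h) * x)) w,
        (uniform ((E → MaskSpace F r x C.h) × (Fin y → F))).map (fun c =>
        C.assemble v (C.blocks v (fun ρ => C.query θ.1 v (u ρ))
          fun e => (C.noise (C.twist split θ u v g) w c).1 e.1,
            (C.noise (C.twist split θ u v g) w c).2)) =
        (indepProd (piLaw fun ρ : SumType r × Fin x => (uniform _).map
          (C.code v (C.query θ.1 v (u ρ)))) (uniform (Fin y → F))).map (C.assemble v) := by
      intro u g w
      have := congrArg (PMF.map fun n : (E → MaskSpace F r x C.h) × (Fin y → F) =>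
        C.assemble v (C.blocks v (fun ρ => C.query θ.1 v (u ρ)) fun e => n.1 e.1, n.2))
        (C.uniform_map_noise (C.twist split θ u v g) w)
      rw [PMF.map_comp] at this
      refine this.trans ?_
      have h2 : (uniform (E → MaskSpace F r x C.h)).map (fun z =>
          C.blocks v (fun ρ => C.query θ.1 v (u ρ)) fun e => z e.1) =
          piLaw fun ρ : SumType r × Fin x => (uniform _).map (C.code v (C.query θ.1 v (u ρ))) := by
        -- The table of blocks is restricted to the stored edges and transposed, so that each pair
        -- (S, i) indexes an independent input of the code.
        rw [← piLaw_map, ← uniform_pi, ← uniform_map_swap (ι := {e : E // v ∈ ends e}),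
          ← uniform_map_equiv (Equiv.piCongrRight fun _ => (Equiv.curry _ _ _).symm),
          ← uniform_map_restrict (fun e => v ∈ ends e), PMF.map_comp, PMF.map_comp, PMF.map_comp]
        rfl
      rw [← h2, uniform_prod]
      have h3 := indepProd_map_map (uniform (E → MaskSpace F r x C.h)) (uniform (Fin y → F))
        (fun z => C.blocks v (fun ρ => C.query θ.1 v (u ρ)) fun e => z e.1) id
      rw [PMF.map_id] at h3
      rw [← h3, PMF.map_comp]
      rfl
    refine (congrArg _ (funext fun u => (congrArg _ (funext fun g => (congrArg _ (funext fun w =>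
      h1 u g w)).trans (PMF.bind_const _ _))).trans (PMF.bind_const _ _))).trans ?_
    refine (PMF.map_bind _ _ _).symm.trans (congrArg _ ?_)
    have h4 : (piLaw fun _ : SumType r × Fin x => C.answerLaw θ.1 v) = _ :=
      (piLaw_bind (fun _ => C.userLaw)
        (fun _ u => (uniform _).map (C.code v (C.query θ.1 v u)))).symm
    rw [h4]
    simp only [indepProd, PMF.bind_bind]
  refine (entropy_congr_law hlaw).trans ((entropy_comp_injective _ id
    (C.assemble_injective v)).trans ?_)
  refine (entropy_indepProd _ _).trans ?_
  rw [entropy_piLaw, entropy_uniform, Fintype.card_prod, card_sumType, Fintype.card_fin, Nat.card_fun,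
    Nat.card_eq_fintype_card (α := Fin y), Fintype.card_fin, Nat.cast_pow, Real.logb_pow,
    Real.logb_self_eq_one hq]
  push_cast [Nat.one_le_two_pow]
  ring

theorem entropy_randLaw_toProtocol :
    entropy (Nat.card F) (C.toProtocol (r := r) hx split).randLaw id =
      Nat.card E * ((2 ^ r - 1) * (x * C.h)) + y := by
  have hq : (1 : ℝ) < Nat.card F := by exact_mod_cast Finite.one_lt_card
  refine (entropy_uniform (Ω := Shrink.{0} ((E → MaskSpace F r x C.h) × (Fin y → F)))).trans ?_
  rw [← Nat.card_congr (equivShrink.{0} _)]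
  simp only [Nat.card_prod, Nat.card_fun, Nat.card_eq_fintype_card (α := Fin _), Fintype.card_fin,
    Nat.card_eq_fintype_card (α := SumType r), card_sumType, ← pow_mul, ← pow_add]
  rw [Nat.cast_pow, Real.logb_pow, Real.logb_self_eq_one hq]
  push_cast [Nat.one_le_two_pow]
  ring

/-- The conversion of an aligned code into a symmetric scheme. -/
theorem exists_isSPIR [Fintype V] (hN : 2 ≤ Fintype.card V) (r : ℕ) {x y : ℕ} (hx : 0 < x)
    (hxy : x * C.h = (Fintype.card V - 1) * y) :
    ∃ S : Protocol F (multiStorage ends r), S.IsSPIR ∧ S.L = 2 ^ (r - 1) * (2 * C.h) * x ∧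
      (∀ θ, S.download θ = (2 ^ r - 1) * (∑ v, entropy (Nat.card F) (C.answerLaw θ.1 v) id) * x +
        Fintype.card V * y) ∧
      S.numSymbols = (2 ^ r - 1) * (∑ v, C.len v) * x + Fintype.card V * y ∧
      entropy (Nat.card F) S.randLaw id = Nat.card E * ((2 ^ r - 1) * (x * C.h)) + y := by
  classical
  have : Nonempty V := Fintype.card_pos_iff.1 (by lia)
  obtain ⟨v₀⟩ := this
  have hcard : Fintype.card (Fin x × Fin C.h) = Fintype.card ({v : V // v ≠ v₀} × Fin y) := by
    rw [Fintype.card_prod, Fintype.card_prod, Fintype.card_fin, Fintype.card_fin, Fintype.card_fin,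
      hxy, Fintype.card_subtype_compl, Fintype.card_subtype_eq]
  let split := Fintype.equivOfCardEq hcard
  refine ⟨C.toProtocol hx split, ⟨C.userPrivacy_toProtocol hx split, C.reliable_toProtocol hx split,
    C.databasePrivacy_toProtocol hx split⟩, rfl, fun θ => ?_, ?_, C.entropy_randLaw_toProtocol hx split⟩
  · rw [Protocol.download, Finset.sum_congr rfl fun v _ => C.entropy_ans hx split θ v,
      Finset.sum_add_distrib, ← Finset.sum_mul, ← Finset.mul_sum]
    simp
  · change ∑ v, ((2 ^ r - 1) * C.len v * x + y) = _
    rw [Finset.sum_add_distrib, ← Finset.sum_mul, ← Finset.mul_sum]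
    simp

end

end AlignedCode

/-! ### Linear maps over finite fields and their entropy -/

section Linear

variable {F M M' N : Type*} [Field F] [AddCommGroup M] [Module F M] [AddCommGroup M'] [Module F M']
  [AddCommGroup N] [Module F N]

theorem uniform_map_of_surjective [Finite M] [Finite M'] (g : M →ₗ[F] M')
    (hg : Function.Surjective g) : (uniform M).map g = uniform M' := by
  obtain ⟨σ, hσ⟩ := hg.hasRightInverse
  let e : M ≃ M' × LinearMap.ker g :=
    { toFun := fun m => (g m, ⟨m - σ (g m), by rw [LinearMap.mem_ker, map_sub, hσ, sub_self]⟩)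
      invFun := fun a => σ a.1 + a.2.1
      left_inv := fun m => by simp
      right_inv := fun ⟨a, b, hb⟩ => by
        rw [LinearMap.mem_ker] at hb
        have h : g (σ a + b) = a := by rw [map_add, hσ, hb, add_zero]
        simp [h] }
  exact uniform_map_of_equiv_prod e

theorem entropy_linearMap [Finite F] [Finite M] (g : M →ₗ[F] N) :
    entropy (Nat.card F) (uniform M) g = Module.finrank F (LinearMap.range g) := by
  have hq : (1 : ℝ) < Nat.card F := by exact_mod_cast Finite.one_lt_card
  have : Finite (LinearMap.range g) := Set.finite_range g
  have h1 := entropy_comp_injective (b := Nat.card F) (uniform M) g.rangeRestrict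
    (Subtype.val_injective (p := fun x => x ∈ LinearMap.range g))
  refine h1.trans ?_
  rw [← entropy_map, uniform_map_of_surjective _ g.surjective_rangeRestrict, entropy_uniform,
    Module.natCard_eq_pow_finrank (K := F) (V := LinearMap.range g), Nat.cast_pow, Real.logb_pow, Real.logb_self_eq_one hq,
    mul_one]

/-- A linear map of rank `h` factors through a surjection onto `F ^ h`. -/
theorem exists_factorization [FiniteDimensional F M] (A : M →ₗ[F] N) (h : ℕ) :
    ∃ (φ : (Fin h → F) →ₗ[F] N) (π : M →ₗ[F] (Fin h → F)),
      Module.finrank F (LinearMap.range A) = h → Function.Surjective π ∧ φ ∘ₗ π = A := by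
  by_cases hA : Module.finrank F (LinearMap.range A) = h
  · let e : LinearMap.range A ≃ₗ[F] (Fin h → F) :=
      LinearEquiv.ofFinrankEq _ _ (by rw [hA, Module.finrank_fin_fun])
    refine ⟨(LinearMap.range A).subtype ∘ₗ e.symm.toLinearMap, e.toLinearMap ∘ₗ A.rangeRestrict,
      fun _ => ⟨e.surjective.comp A.surjective_rangeRestrict, ?_⟩⟩
    ext m
    simp
  -- The rank condition stands inside the existential so that maps can be chosen for all query
  -- values, including those of probability zero.
  · exact ⟨0, 0, fun h => absurd h hA⟩

theorem exists_comp_eq_of_ker_le (J : M →ₗ[F] N) (g : M →ₗ[F] M')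
    (h : LinearMap.ker J ≤ LinearMap.ker g) : ∃ D : N →ₗ[F] M', ∀ m, D (J m) = g m := by
  obtain ⟨D, hD⟩ := LinearMap.exists_extend
    ((LinearMap.ker J).liftQ g h ∘ₗ J.quotKerEquivRange.symm.toLinearMap)
  refine ⟨D, fun m => ?_⟩
  have h1 := LinearMap.congr_fun hD ⟨J m, LinearMap.mem_range_self J m⟩
  have h2 : J.quotKerEquivRange.symm ⟨J m, LinearMap.mem_range_self J m⟩ =
      (LinearMap.ker J).mkQ m := by
    rw [LinearEquiv.symm_apply_eq]
    rfl
  rw [LinearMap.comp_apply, LinearMap.comp_apply, LinearEquiv.coe_coe, h2] at h1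
  simpa using h1

/-- Two linear maps with the same range differ by an automorphism of their source. -/
theorem exists_linearEquiv_comp_eq [FiniteDimensional F M] (X Y : M →ₗ[F] N)
    (h : LinearMap.range X = LinearMap.range Y) : ∃ C : M ≃ₗ[F] M, ∀ m, Y (C m) = X m := by
  obtain ⟨p, hp⟩ := Submodule.exists_isCompl (LinearMap.ker X)
  obtain ⟨q, hq⟩ := Submodule.exists_isCompl (LinearMap.ker Y)
  have hker : Module.finrank F (LinearMap.ker X) = Module.finrank F (LinearMap.ker Y) := by
    have h1 := LinearMap.finrank_range_add_finrank_ker X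
    have h2 := LinearMap.finrank_range_add_finrank_ker Y
    rw [h] at h1
    lia
  let e₁ : p ≃ₗ[F] q := (X.kerComplementEquivRange hp.symm).trans
    ((LinearEquiv.ofEq _ _ h).trans (Y.kerComplementEquivRange hq.symm).symm)
  let e₂ : LinearMap.ker X ≃ₗ[F] LinearMap.ker Y := LinearEquiv.ofFinrankEq _ _ hker
  have he₁ : ∀ a : p, Y (e₁ a) = X a := by
    intro a
    have h1 : Y.kerComplementEquivRange hq.symm (e₁ a) =
        LinearEquiv.ofEq _ _ h (X.kerComplementEquivRange hp.symm a) := by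
      simp only [e₁, LinearEquiv.trans_apply, LinearEquiv.apply_symm_apply]
    exact congrArg Subtype.val h1
  let P := Submodule.prodEquivOfIsCompl p _ hp.symm
  let Q := Submodule.prodEquivOfIsCompl q _ hq.symm
  refine ⟨P.symm.trans ((e₁.prodCongr e₂).trans Q), fun m => ?_⟩
  obtain ⟨⟨a, b⟩, rfl⟩ := P.surjective m
  rw [LinearEquiv.trans_apply, LinearEquiv.symm_apply_apply]
  change Y ((e₁ a : M) + e₂ b) = X ((a : M) + b)
  rw [map_add, map_add, he₁, LinearMap.mem_ker.1 b.2, LinearMap.mem_ker.1 (e₂ b).2]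

end Linear

variable {F : Type*} [Field F] [Finite F] {V E : Type*} [Finite E] {ends : E → Sym2 V}

open Classical in
/-- Given the other messages, a linear answer carries as much information on a message as the rank
of its coefficients. -/
theorem condEntropy_linear {L : ℕ} {X : Type*} [AddCommGroup X] [Module F X] {v : V} {k : E}
    (hk : v ∈ ends k) (f : ({e : E // v ∈ ends e} → Fin L → F) →ₗ[F] X) :
    condEntropy (Nat.card F) (uniform (E → Fin L → F)) (fun w => f (storedPart ends v w))
      (fun w => fun e : {e : E // v ∈ ends e ∧ e ≠ k} => w e.1) =
      Module.finrank F (LinearMap.range (f ∘ₗ LinearMap.single F _ ⟨k, hk⟩)) := by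
  set A := f ∘ₗ LinearMap.single F (fun _ => Fin L → F) ⟨k, hk⟩ with hA
  let rest : ({e : E // v ∈ ends e ∧ e ≠ k} → Fin L → F) → ({e : E // v ∈ ends e} → Fin L → F) :=
    fun a e => if he : e.1 = k then 0 else a ⟨e.1, e.2, he⟩
  let ψ : ({e : E // v ∈ ends e ∧ e ≠ k} → Fin L → F) × X →
      X × ({e : E // v ∈ ends e ∧ e ≠ k} → Fin L → F) := fun a => (a.2 + f (rest a.1), a.1)
  have hψ : Function.Injective ψ := by
    rintro ⟨a, b⟩ ⟨a', b'⟩ h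
    obtain ⟨h1, h2⟩ := Prod.ext_iff.1 h
    obtain rfl : a = a' := h2
    exact Prod.ext rfl (add_right_cancel h1)
  have hpair : (fun w : E → Fin L → F => (f (storedPart ends v w),
      fun e : {e : E // v ∈ ends e ∧ e ≠ k} => w e.1)) =
      fun w => ψ ((fun e : {e : E // v ∈ ends e ∧ e ≠ k} => w e.1), A (w k)) := by
    -- Given the other messages, the answer and the contribution of the message k determine each
    -- other; and that contribution is independent of the other messages.
    funext w
    refine Prod.ext ?_ rfl
    simp only [ψ, hA, LinearMap.comp_apply, ← map_add]
    congr 1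
    funext e
    by_cases he : e.1 = k
    · obtain ⟨e, he'⟩ := e
      subst he
      simp [rest, storedPart]
    · have : e ≠ ⟨k, hk⟩ := fun h => he (congrArg Subtype.val h)
      simp [rest, storedPart, he, this]
  have hind : (uniform (E → Fin L → F)).map
      (fun w => ((fun e : {e : E // v ∈ ends e ∧ e ≠ k} => w e.1), A (w k))) =
      indepProd ((uniform ({e : E // e ≠ k} → Fin L → F)).map
        fun a (e : {e : E // v ∈ ends e ∧ e ≠ k}) => a ⟨e.1, e.2.2⟩) ((uniform _).map A) := by
    rw [← indepProd_map_map, ← AlignedCode.uniform_map_coordinate k, PMF.map_comp]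
    rfl
  have h1 : entropy (Nat.card F) (uniform (E → Fin L → F)) (fun w => A (w k)) =
      entropy (Nat.card F) (uniform (Fin L → F)) A := by
    refine entropy_congr_law ?_
    have := congrArg (PMF.map fun a => A a.2)
      (AlignedCode.uniform_map_coordinate (α := Fin L → F) k)
    rw [PMF.map_comp] at this
    refine this.trans ?_
    rw [← indepProd_map_snd (uniform ({e : E // e ≠ k} → Fin L → F)) (uniform (Fin L → F)),
      PMF.map_comp, indepProd_map_snd]
    rfl
  rw [condEntropy, hpair, entropy_comp_injective _ _ hψ, entropy_pair_of_indep _ _ _ _ _ hind, h1,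
    entropy_linearMap]
  ring

/-! ### Linear schemes with symmetric retrieval are aligned codes -/

namespace Protocol

variable {T : Protocol F ends}

theorem law_map_user (T : Protocol F ends) {β : Type*} (f : T.U → β) :
    T.law.map (fun ω => f ω.1) = T.userLaw.map f := by
  rw [← indepProd_map_fst T.userLaw T.contentLaw, PMF.map_comp]
  rfl

theorem IsPIR.map_query (hT : T.IsPIR) (v : V) (k k' : E) :
    T.userLaw.map (T.query k v) = T.userLaw.map (T.query k' v) := by
  have := congrArg (PMF.map Prod.fst) (hT.userPrivacy v k k')
  rw [PMF.map_comp, PMF.map_comp] at this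
  rw [← T.law_map_user, ← T.law_map_user]
  exact this

/-- A linear scheme without server randomness has linear answer maps. -/
theorem exists_linear (hT : T.IsPIR) (hlin : T.IsLinear) :
    ∃ f : ∀ (v : V), T.Query v → ({e : E // v ∈ ends e} → Fin T.L → F) →ₗ[F] (Fin (T.len v) → F),
      ∀ v q w s, T.answer v q w s = f v q w := by
  obtain ⟨s₀, _⟩ := T.randLaw.support_nonempty
  choose f hf using fun v q => hlin v q s₀
  have := hT.no_randomness
  exact ⟨f, fun v q w s => by rw [Subsingleton.elim s s₀, hf]⟩

theorem contentLaw_map_fst (T : Protocol F ends) {β : Type*} (f : (E → Fin T.L → F) → β) :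
    T.contentLaw.map (fun c => f c.1) = (uniform _).map f := by
  rw [← indepProd_map_fst (uniform (E → Fin T.L → F)) T.randLaw, PMF.map_comp]
  rfl

section

variable {f : ∀ (v : V), T.Query v →
  ({e : E // v ∈ ends e} → Fin T.L → F) →ₗ[F] (Fin (T.len v) → F)}
  (hf : ∀ v q w s, T.answer v q w s = f v q w)

include hf

-- SRP speaks only of queries for a message stored on the server. By user privacy each possible
-- query for k is also a possible query for e, so every stored message, wanted or not, enters the
-- answer with rank L/2.
open Classical in
theorem rank_eq (hT : T.IsPIR) (hS : T.SRP) (k : E) {u : T.U} (hu : u ∈ T.userLaw.support) (v : V)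
    (e : {e : E // v ∈ ends e}) :
    2 * Module.finrank F (LinearMap.range (f v (T.query k v u) ∘ₗ LinearMap.single F _ e)) =
      T.L := by
  have hmem : T.query k v u ∈ (T.userLaw.map (T.query e.1 v)).support := by
    rw [hT.map_query v e.1 k, PMF.support_map]
    exact ⟨u, hu, rfl⟩
  rw [PMF.support_map] at hmem
  obtain ⟨u', hu', hq⟩ := hmem
  have h := hS e.1 v e.2 u' hu'
  simp only [hf, hq] at h
  have := T.finite_R
  have h1 := condEntropy_linear e.2 (f v (T.query k v u))
  rw [condEntropy] at h h1
  rw [entropy_congr_law (T.contentLaw_map_fst fun w => (f v (T.query k v u) (storedPart ends v w),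
    fun e' : {e' : E // v ∈ ends e' ∧ e' ≠ e.1} => w e'.1)),
    entropy_congr_law (T.contentLaw_map_fst fun w =>
      fun e' : {e' : E // v ∈ ends e' ∧ e' ≠ e.1} => w e'.1), h1] at h
  have h2 : ((2 * Module.finrank F (LinearMap.range
      (f v (T.query k v u) ∘ₗ LinearMap.single F _ e)) : ℕ) : ℝ) = T.L := by
    push_cast
    linarith
  exact_mod_cast h2

/-- The wanted message is a linear function of the answers. -/
theorem exists_decoder (hT : T.IsPIR) (k : E) {u : T.U} (hu : u ∈ T.userLaw.support) :
    ∃ D : ((v : V) → Fin (T.len v) → F) →ₗ[F] (Fin T.L → F), ∀ w : E → Fin T.L → F,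
      D (fun v => f v (T.query k v u) (storedPart ends v w)) = w k := by
  let J : (E → Fin T.L → F) →ₗ[F] ((v : V) → Fin (T.len v) → F) :=
    LinearMap.pi fun v => f v (T.query k v u) ∘ₗ
      LinearMap.funLeft F (Fin T.L → F) (Subtype.val : {e : E // v ∈ ends e} → E)
  -- By linearity it suffices that a database with zero answers has zero wanted message; reliability
  -- is applied to it and the zero database.
  refine exists_comp_eq_of_ker_le J (LinearMap.proj k) fun w hw => ?_
  have := T.finite_R
  have := T.finite_U
  obtain ⟨s, hs⟩ := T.randLaw.support_nonempty
  have hsupp : ∀ w, ((u, w, s) : T.U × (E → Fin T.L → F) × T.R) ∈ T.law.support := fun w =>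
    (mem_support_indepProd _ _ _).2 ⟨hu, (mem_support_indepProd _ _ _).2
      ⟨mem_support_uniform w, hs⟩⟩
  have h := (condEntropy_eq_zero_iff Finite.one_lt_card _ _ _).1 (hT.reliable k) _ (hsupp w) _
    (hsupp 0)
  refine h (Prod.ext (funext fun v => ?_) rfl)
  have h1 : f v (T.query k v u) (storedPart ends v w) = 0 := congrFun (LinearMap.mem_ker.1 hw) v
  simp only [ans, hf]
  rw [h1, show storedPart ends v (0 : E → Fin T.L → F) = 0 from rfl, map_zero]

end

open Classical in
/-- A linear scheme with symmetric retrieval is an aligned code. -/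
theorem exists_alignedCode [Nonempty E] (hT : T.IsPIR) (hlin : T.IsLinear) (hS : T.SRP)
    (base other : E → V) (hends : ∀ e, ends e = s(base e, other e))
    (hne : ∀ e, other e ≠ base e) :
    ∃ C : AlignedCode F ends, T.L = 2 * C.h ∧ C.len = T.len ∧
      ∀ k v, entropy (Nat.card F) (C.answerLaw k v) id = entropy (Nat.card F) T.law (T.ans k v) := by
  let _ := Fintype.ofFinite E
  have hbase : ∀ e, base e ∈ ends e := fun e => by rw [hends]; exact Sym2.mem_mk_left _ _
  have hother : ∀ e, other e ∈ ends e := fun e => by rw [hends]; exact Sym2.mem_mk_right _ _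
  have hmem : ∀ {e v}, v ∈ ends e → v = base e ∨ v = other e := fun {e v} h => by
    rw [hends] at h; exact Sym2.mem_iff.1 h
  obtain ⟨f, hf⟩ := exists_linear hT hlin
  obtain ⟨h, hL⟩ : ∃ h, T.L = 2 * h := by
    obtain ⟨k⟩ := ‹Nonempty E›
    obtain ⟨u, hu⟩ := T.userLaw.support_nonempty
    exact ⟨_, (rank_eq hf hT hS k hu (base k) ⟨k, hbase k⟩).symm⟩
  have hpos : 0 < h := by have := T.L_pos; lia
  choose φ π hφ using fun (v : V) (q : T.Query v) (e : {e : E // v ∈ ends e}) =>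
    exists_factorization (f v q ∘ₗ LinearMap.single F (fun _ => Fin T.L → F) e) h
  have hφ' : ∀ k, ∀ u ∈ T.userLaw.support, ∀ v e, Function.Surjective (π v (T.query k v u) e) ∧
      φ v (T.query k v u) e ∘ₗ π v (T.query k v u) e =
        f v (T.query k v u) ∘ₗ LinearMap.single F (fun _ => Fin T.L → F) e := fun k u hu v e =>
    hφ v _ e (by have := rank_eq hf hT hS k hu v e; lia)
  have hD : ∀ k u, ∃ D : ((v : V) → Fin (T.len v) → F) →ₗ[F] (Fin T.L → F),
      u ∈ T.userLaw.support → ∀ w : E → Fin T.L → F,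
        D (fun v => f v (T.query k v u) (storedPart ends v w)) = w k := by
    intro k u
    by_cases hu : u ∈ T.userLaw.support
    · obtain ⟨D, hD⟩ := exists_decoder hf hT k hu
      exact ⟨D, fun _ => hD⟩
    · exact ⟨0, fun h => absurd h hu⟩
  choose D hD using hD
  -- The effect on the decoder's output of the block of e at server v.
  let X : ∀ (_ : E) (_ : T.U) (v : V) (_ : {e : E // v ∈ ends e}), (Fin h → F) →ₗ[F] (Fin T.L → F) :=
    fun k u v e => D k u ∘ₗ LinearMap.single F (fun v => Fin (T.len v) → F) v ∘ₗ
      φ v (T.query k v u) e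
  -- The decoder is applied to the database whose only nonzero message is m in place e.
  have hX : ∀ k, ∀ u ∈ T.userLaw.support, ∀ e m,
      X k u (base e) ⟨e, hbase e⟩ (π (base e) (T.query k (base e) u) ⟨e, hbase e⟩ m) +
        X k u (other e) ⟨e, hother e⟩ (π (other e) (T.query k (other e) u) ⟨e, hother e⟩ m) =
      (Pi.single e m : E → Fin T.L → F) k := by
    intro k u hu e m
    rw [← hD k u hu (Pi.single e m)]
    simp only [X, LinearMap.comp_apply, ← map_add]
    congr 1
    funext v
    have h1 : ∀ (v : V) (hv : v ∈ ends e), φ v (T.query k v u) ⟨e, hv⟩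
        (π v (T.query k v u) ⟨e, hv⟩ m) =
        f v (T.query k v u) (storedPart ends v (Pi.single e m)) := by
      intro v hv
      have := LinearMap.congr_fun (hφ' k u hu v ⟨e, hv⟩).2 m
      rw [LinearMap.comp_apply, LinearMap.comp_apply] at this
      rw [this]
      congr 1
      funext e'
      by_cases he : e' = ⟨e, hv⟩
      · subst he
        simp [storedPart]
      · have he' : e'.1 ≠ e := fun h => he (Subtype.ext h)
        simp [storedPart, he, he']
    rw [h1, h1]
    by_cases hv : v ∈ ends e
    · rcases hmem hv with rfl | rfl
      · simp [(hne e).symm]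
      · simp [hne e]
    · have hb : v ≠ base e := fun h => hv (h ▸ hbase e)
      have ho : v ≠ other e := fun h => hv (h ▸ hother e)
      have h0 : storedPart ends v (Pi.single e m : E → Fin T.L → F) = 0 := by
        funext e'
        have he' : e'.1 ≠ e := fun h => hv (h ▸ e'.2)
        simp [storedPart, he']
      rw [h0, map_zero]
      simp [hb, ho]
  have hC : ∀ k u e, ∃ C : (Fin h → F) ≃ₗ[F] (Fin h → F), u ∈ T.userLaw.support → e ≠ k →
      ∀ m, X k u (other e) ⟨e, hother e⟩ (C m) = -X k u (base e) ⟨e, hbase e⟩ m := by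
    intro k u e
    by_cases hue : u ∈ T.userLaw.support ∧ e ≠ k
    · obtain ⟨hu, he⟩ := hue
      have hsum : ∀ m, X k u (base e) ⟨e, hbase e⟩
          (π (base e) (T.query k (base e) u) ⟨e, hbase e⟩ m) = -X k u (other e) ⟨e, hother e⟩
            (π (other e) (T.query k (other e) u) ⟨e, hother e⟩ m) := fun m => by
        rw [eq_neg_iff_add_eq_zero, hX k u hu, Pi.single_eq_of_ne he.symm]
      -- The two contributions of an unwanted message cancel, and both block maps π are onto, so the
      -- two ranges coincide.
      obtain ⟨C, hC⟩ := exists_linearEquiv_comp_eq (-X k u (base e) ⟨e, hbase e⟩)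
        (X k u (other e) ⟨e, hother e⟩) (by
          apply le_antisymm
          · rintro _ ⟨a, rfl⟩
            obtain ⟨m, rfl⟩ := (hφ' k u hu (base e) ⟨e, hbase e⟩).1 a
            exact ⟨_, by rw [LinearMap.neg_apply, hsum, neg_neg]⟩
          · rintro _ ⟨a, rfl⟩
            obtain ⟨m, rfl⟩ := (hφ' k u hu (other e) ⟨e, hother e⟩).1 a
            exact ⟨_, by rw [LinearMap.neg_apply, hsum, neg_neg]⟩)
      exact ⟨C, fun _ _ => hC⟩
    · exact ⟨LinearEquiv.refl _ _, fun hu he => absurd ⟨hu, he⟩ hue⟩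
  choose align halign using hC
  let code : (v : V) → T.Query v → ({e : E // v ∈ ends e} → Fin h → F) → Fin (T.len v) → F :=
    fun v q z => ∑ e : E, if hv : v ∈ ends e then φ v q ⟨e, hv⟩ (z ⟨e, hv⟩) else 0
  have hcode : ∀ k u (z : E → V → Fin h → F),
      D k u (fun v => code v (T.query k v u) fun e => z e.1 v) = ∑ e,
        (X k u (base e) ⟨e, hbase e⟩ (z e (base e)) +
          X k u (other e) ⟨e, hother e⟩ (z e (other e))) := by
    intro k u z
    simp only [X, LinearMap.comp_apply, ← map_add, ← map_sum]
    congr 1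
    funext v
    rw [Finset.sum_apply]
    refine Finset.sum_congr rfl fun e _ => ?_
    by_cases hv : v ∈ ends e
    · rw [dif_pos hv]
      rcases hmem hv with rfl | rfl
      · simp [(hne e).symm]
      · simp [hne e]
    · have hb : v ≠ base e := fun h => hv (h ▸ hbase e)
      have ho : v ≠ other e := fun h => hv (h ▸ hother e)
      simp [hv, hb, ho]
  have hdec : ∀ k, ∀ u ∈ T.userLaw.support, ∀ z : E → V → Fin h → F,
      (∀ e, e ≠ k → z e (other e) = align k u e (z e (base e))) →
      D k u (fun v => code v (T.query k v u) fun e => z e.1 v) =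
        X k u (base k) ⟨k, hbase k⟩ (z k (base k)) +
          X k u (other k) ⟨k, hother k⟩ (z k (other k)) := by
    intro k u hu z hz
    rw [hcode, Finset.sum_eq_single k]
    · intro e _ he
      rw [hz e he, halign k u e hu he, add_neg_cancel]
    · simp
  let C : AlignedCode F ends :=
    { base := base
      other := other
      other_ne := hne
      h := h
      h_pos := hpos
      U := T.U
      finite_U := T.finite_U
      userLaw := T.userLaw
      Query := T.Query
      query := T.query
      len := T.len
      code := code
      align := fun k u e => (align k u e).toAddEquiv
      map_query := hT.map_query
      decodes := by
        intro k u hu z z' hz hz' H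
        have h1 := hdec k u hu z hz
        rw [funext H, hdec k u hu z' hz'] at h1
        let P := (X k u (base k) ⟨k, hbase k⟩).coprod (X k u (other k) ⟨k, hother k⟩)
        have hsurj : Function.Surjective P := by
          intro m
          have := hX k u hu k m
          rw [Pi.single_eq_same] at this
          exact ⟨(_, _), (LinearMap.coprod_apply _ _ _).trans this⟩
        -- The two blocks have 2h symbols and the message has L = 2h, so a surjective decoder is
        -- injective.
        have hinj : Function.Injective P :=
          (LinearMap.injective_iff_surjective_of_finrank_eq_finrank (by
            rw [Module.finrank_prod, Module.finrank_fin_fun, Module.finrank_fin_fun, hL]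
            ring)).2 hsurj
        have h2 : P (z k (base k), z k (other k)) = P (z' k (base k), z' k (other k)) := by
          rw [LinearMap.coprod_apply, LinearMap.coprod_apply]
          exact h1.symm
        exact Prod.ext_iff.1 (hinj h2) }
  refine ⟨C, hL, rfl, fun k v => ?_⟩
  have := T.finite_U
  have := T.finite_R
  refine (entropy_congr_law (?_ : T.law.map (T.ans k v) = (C.answerLaw k v).map id)).symm
  rw [PMF.map_id]
  have h1 : T.law.map (T.ans k v) = T.userLaw.bind fun u =>
      (uniform (E → Fin T.L → F)).map fun w => f v (T.query k v u) (storedPart ends v w) := by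
    refine (indepProd_map _ _ _).trans (congrArg _ (funext fun u => ?_))
    rw [← T.contentLaw_map_fst]
    exact congrArg (PMF.map · _) (funext fun c => hf _ _ _ _)
  rw [h1]
  -- The factorization of the answer through blocks is available only for queries of positive
  -- probability.
  refine bind_congr_support _ fun u hu => ?_
  have h2 : ∀ w : {e : E // v ∈ ends e} → Fin T.L → F, f v (T.query k v u) w =
      code v (T.query k v u) fun e => π v (T.query k v u) e (w e) := by
    intro w
    have h3 : ∀ e : {e : E // v ∈ ends e}, (if hv : v ∈ ends e.1 then
        φ v (T.query k v u) ⟨e.1, hv⟩ (π v (T.query k v u) ⟨e.1, hv⟩ (w ⟨e.1, hv⟩)) else 0) =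
        f v (T.query k v u) (Pi.single e (w e)) := by
      intro e
      rw [dif_pos e.2]
      exact LinearMap.congr_fun (hφ' k u hu v e).2 (w e)
    simp only [code]
    rw [← Fintype.sum_subtype_add_sum_subtype (fun e => v ∈ ends e),
      Finset.sum_congr rfl fun e _ => h3 e,
      Finset.sum_eq_zero (s := (univ : Finset {e : E // ¬v ∈ ends e})) fun e _ => dif_neg e.2,
      add_zero, ← map_sum, Finset.univ_sum_single]
  have h3 : (uniform ({e : E // v ∈ ends e} → Fin h → F)) = (uniform (E → Fin T.L → F)).map
      fun w e => π v (T.query k v u) e (w e.1) := by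
    have h4 := piLaw_map (fun _ : {e : E // v ∈ ends e} => uniform (Fin T.L → F))
      fun e => π v (T.query k v u) e
    rw [← uniform_pi, ← uniform_map_restrict (fun e => v ∈ ends e), PMF.map_comp] at h4
    rw [uniform_pi]
    refine Eq.trans ?_ h4.symm
    congr 1
    funext e
    exact (uniform_map_of_surjective _ (hφ' k u hu v e).1).symm
  change _ = (uniform ({e : E // v ∈ ends e} → Fin h → F)).map (code v (T.query k v u))
  rw [h3, PMF.map_comp]
  exact congrArg (PMF.map · _) (funext fun w => h2 _)

end Protocol

/-! ### Rate and randomness ratio; codes without user randomness -/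

section Static

variable {F : Type*} [Field F] [Finite F] {V E : Type*} [Finite E] {ends : E → Sym2 V}

namespace AlignedCode

/-- The parameters of the symmetric scheme of an aligned code. -/
theorem exists_scheme [Fintype V] (C : AlignedCode F ends) {r : ℕ} (hr : 1 ≤ r)
    (hN : 2 ≤ Fintype.card V) {x y : ℕ} (hx : 0 < x) (hxy : x * C.h = (Fintype.card V - 1) * y) :
    ∃ S : Protocol F (multiStorage ends r), S.IsSPIR ∧ S.L = 2 ^ (r - 1) * (2 * C.h) * x ∧
      (∀ θ, S.rate θ = 2 ^ (r - 1) * (2 * C.h) * x / ((2 ^ r - 1) *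
        (∑ v, entropy (Nat.card F) (C.answerLaw θ.1 v) id) * x + Fintype.card V * y)) ∧
      S.numSymbols = (2 ^ r - 1) * (∑ v, C.len v) * x + Fintype.card V * y ∧
      S.randomnessRatio = (Fintype.card V * y : ℝ) / (2 ^ (r - 1) * x * (2 * C.h)) -
        (Nat.card E + 1) / 2 ^ r + Nat.card E := by
  obtain ⟨S, hS, hL, hD, hnum, hR⟩ := C.exists_isSPIR hN r hx hxy
  have hL' : (S.L : ℝ) = 2 ^ (r - 1) * (2 * C.h) * x := by rw [hL]; push_cast; ring
  refine ⟨S, hS, hL, fun θ => by rw [Protocol.rate, hL', hD], hnum, ?_⟩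
  rw [Protocol.randomnessRatio, hR, hL']
  -- Writing y = Ny - xh turns the contribution of the common noise into the Ny term and a further
  -- -1/2^r.
  have hxy' : (x : ℝ) * C.h = (Fintype.card V - 1) * y := by
    have := congrArg (Nat.cast : ℕ → ℝ) hxy
    rw [Nat.cast_mul, Nat.cast_mul, Nat.cast_sub (by lia)] at this
    exact_mod_cast this
  obtain ⟨m, rfl⟩ : ∃ m, r = m + 1 := ⟨r - 1, by lia⟩
  have hx' : (0 : ℝ) < x := by exact_mod_cast hx
  have hh : (0 : ℝ) < C.h := by exact_mod_cast C.h_pos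
  have hp : (0 : ℝ) < 2 ^ m := by positivity
  rw [Nat.add_sub_cancel, pow_succ]
  field_simp
  linear_combination hxy'

/-- A code without user randomness whose answers are uniform. -/
theorem exists_static {h : ℕ} (hh : 0 < h) (base other : E → V)
    (hne : ∀ e, other e ≠ base e) (len : V → ℕ)
    (code : ∀ v, ({e : E // v ∈ ends e} → Fin h → F) →ₗ[F] (Fin (len v) → F))
    (hsurj : ∀ v, Function.Surjective (code v))
    (hdec : ∀ (k : E) (d : E → V → Fin h → F), (∀ e, e ≠ k → d e (other e) = d e (base e)) →
      (∀ v, code v (fun e => d e.1 v) = 0) → d k (base k) = 0 ∧ d k (other k) = 0) :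
    ∃ C : AlignedCode F ends, C.h = h ∧ C.len = len ∧
      ∀ k v, entropy (Nat.card F) (C.answerLaw k v) id = len v := by
  have hq : (1 : ℝ) < Nat.card F := by exact_mod_cast Finite.one_lt_card
  refine ⟨{
    base := base
    other := other
    other_ne := hne
    h := h
    h_pos := hh
    U := Unit
    finite_U := inferInstance
    userLaw := PMF.pure ()
    Query := fun _ => Unit
    query := fun _ _ _ => ()
    len := len
    code := fun v _ => code v
    align := fun _ _ _ => AddEquiv.refl _
    map_query := fun _ _ _ => rfl
    decodes := by
      intro k u _ z z' hz hz' H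
      -- Everything is linear and the alignment is the identity, so the difference of two
      -- configurations is tied and encoded to zero.
      have := hdec k (fun e v => z e v - z' e v) (fun e he => by rw [hz e he, hz' e he]; rfl)
        (fun v => by
          have h1 := H v
          rw [← sub_eq_zero, ← map_sub] at h1
          exact h1)
      exact ⟨sub_eq_zero.1 this.1, sub_eq_zero.1 this.2⟩ }, rfl, rfl, fun k v => ?_⟩
  change entropy (Nat.card F) ((PMF.pure ()).bind fun _ => (uniform _).map (code v)) id = _
  rw [PMF.pure_bind, uniform_map_of_surjective _ (hsurj v), entropy_uniform, Nat.card_fun,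
    Nat.card_eq_fintype_card (α := Fin _), Fintype.card_fin, Nat.cast_pow, Real.logb_pow,
    Real.logb_self_eq_one hq, mul_one]

end AlignedCode

/-- The sum of the blocks of all messages stored on server `v`. -/
def sumMap (F : Type*) [Field F] (ends : E → Sym2 V) (h : ℕ) (v : V) :
    ({e : E // v ∈ ends e} → Fin h → F) →ₗ[F] (Fin h → F) :=
  letI := Fintype.ofFinite {e : E // v ∈ ends e}
  ∑ e, LinearMap.proj e

omit [Finite F] in
theorem sumMap_apply_eq {h : ℕ} {v : V} (e : {e : E // v ∈ ends e})
    (z : {e : E // v ∈ ends e} → Fin h → F) (j : Fin h) (hz : ∀ e', e' ≠ e → z e' j = 0) :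
    sumMap F ends h v z j = z e j := by
  let _ := Fintype.ofFinite {e : E // v ∈ ends e}
  change (∑ e, LinearMap.proj e : _ →ₗ[F] _) z j = _
  rw [LinearMap.sum_apply, Finset.sum_apply, Finset.sum_eq_single e]
  · rfl
  · exact fun e' _ he' => hz e' he'
  · simp

omit [Finite F] in
theorem sumMap_single {h : ℕ} {v : V} [DecidableEq {e : E // v ∈ ends e}] (e : {e : E // v ∈ ends e}) (a : Fin h → F) :
    sumMap F ends h v (Pi.single e a) = a := by
  funext j
  rw [sumMap_apply_eq e _ j fun e' he' => by rw [Pi.single_eq_of_ne he']; rfl, Pi.single_eq_same]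

end Static

/-! ### Aligned codes for paths and cycles -/

variable (F : Type*) [Field F] [Finite F]

/-- Each server sends the sum of its one-symbol blocks. An end server reveals its only block; tied
blocks are then peeled off from both ends until the wanted edge is reached from either side. -/
theorem exists_alignedCode_path {N : ℕ} (hN : 2 ≤ N) :
    ∃ C : AlignedCode F (graphStorage (SimpleGraph.pathGraph N)), C.h = 1 ∧
      ∀ k v, entropy (Nat.card F) (C.answerLaw k v) id = 1 := by
  classical
  have hex : ∀ e : (SimpleGraph.pathGraph N).edgeSet, ∃ a b : Fin N,
      a.1 + 1 = b.1 ∧ e.1 = s(a, b) := by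
    rintro ⟨e, he⟩
    induction e using Sym2.ind with
    | _ a b =>
      rw [SimpleGraph.mem_edgeSet, SimpleGraph.pathGraph_adj] at he
      rcases he with h | h
      · exact ⟨a, b, h, rfl⟩
      · exact ⟨b, a, h, Sym2.eq_swap⟩
  choose base other hbo hends using hex
  have hne : ∀ e, other e ≠ base e := fun e h => by
    have := hbo e
    rw [h] at this
    lia
  have hmem : ∀ {e : (SimpleGraph.pathGraph N).edgeSet} {v},
      v ∈ graphStorage (SimpleGraph.pathGraph N) e → v = base e ∨ v = other e := fun {e v} h => by
    rw [graphStorage, hends] at h; exact Sym2.mem_iff.1 h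
  have hbase : ∀ e, base e ∈ graphStorage (SimpleGraph.pathGraph N) e := fun e => by
    rw [graphStorage, hends]; exact Sym2.mem_mk_left _ _
  have hother : ∀ e, other e ∈ graphStorage (SimpleGraph.pathGraph N) e := fun e => by
    rw [graphStorage, hends]; exact Sym2.mem_mk_right _ _
  have hinj : ∀ {e e'}, base e = base e' → e = e' := fun {e e'} h => by
    refine Subtype.ext ?_
    have h1 := hbo e
    have h2 := hbo e'
    rw [hends, hends, h, Fin.ext (a := other e) (b := other e') (by rw [← h1, ← h2, h])]
  have hinj' : ∀ {e e'}, other e = other e' → e = e' := fun {e e'} h => by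
    refine hinj (Fin.ext ?_)
    have h1 := hbo e
    have h2 := hbo e'
    rw [h] at h1
    lia
  obtain ⟨C, hh, _, hC⟩ := AlignedCode.exists_static (F := F) Nat.one_pos base other hne
    (fun _ => 1) (fun v => sumMap F (graphStorage (SimpleGraph.pathGraph N)) 1 v)
    (by
      intro v a
      obtain ⟨e⟩ : Nonempty {e // v ∈ graphStorage (SimpleGraph.pathGraph N) e} := by
        -- The sum is onto as soon as the server stores a message: the edge to the right, or at the
        -- last vertex the edge to the left.
        by_cases hv : v.1 + 1 < N
        · refine ⟨⟨⟨s(v, ⟨v.1 + 1, hv⟩), ?_⟩, Sym2.mem_mk_left _ _⟩⟩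
          rw [SimpleGraph.mem_edgeSet, SimpleGraph.pathGraph_adj]
          exact Or.inl rfl
        · have hv' := v.2
          refine ⟨⟨⟨s(v, ⟨v.1 - 1, by lia⟩), ?_⟩, Sym2.mem_mk_left _ _⟩⟩
          rw [SimpleGraph.mem_edgeSet, SimpleGraph.pathGraph_adj]
          right
          change v.1 - 1 + 1 = v.1
          lia
      exact ⟨_, sumMap_single e a⟩)
    (by
      intro k d hd H
      have hforward : ∀ n e, (base e).1 = n → n ≤ (base k).1 → d e (base e) = 0 := by
        intro n
        induction n using Nat.strong_induction_on with
        | _ n ih =>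
          intro e he hn
          funext j
          have h1 := congrFun (H (base e)) j
          rw [sumMap_apply_eq ⟨e, hbase e⟩] at h1
          · exact h1
          · rintro ⟨e', he'⟩ hne'
            rcases hmem he' with h2 | h2
            · exact absurd (Subtype.ext (hinj h2.symm)) hne'
            · have h3 := hbo e'
              rw [← h2] at h3
              have h4 : e' ≠ k := by
                rintro rfl
                lia
              change d e' (base e) j = 0
              rw [h2, hd e' h4, ih _ (by lia) e' rfl (by lia)]
              rfl
      -- Here n = N - `other e` measures the distance to the right end.
      have hbackward : ∀ n e, (other e).1 + n = N → (other k).1 ≤ (other e).1 →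
          d e (other e) = 0 := by
        intro n
        induction n using Nat.strong_induction_on with
        | _ n ih =>
          intro e he hn
          funext j
          have h1 := congrFun (H (other e)) j
          rw [sumMap_apply_eq ⟨e, hother e⟩] at h1
          · exact h1
          · rintro ⟨e', he'⟩ hne'
            rcases hmem he' with h2 | h2
            · have h3 := hbo e'
              rw [← h2] at h3
              have h4 : e' ≠ k := by
                rintro rfl
                lia
              have h5 := (other e').2
              change d e' (other e) j = 0
              rw [h2, ← hd e' h4, ih (N - (other e').1) (by lia) e' (by lia) (by lia)]
              rfl
            · exact absurd (Subtype.ext (hinj' h2.symm)) hne'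
      exact ⟨hforward _ k rfl le_rfl,
        hbackward (N - (other k).1) k (by have := (other k).2; lia) le_rfl⟩)
  exact ⟨C, hh, fun k v => by rw [hC, Nat.cast_one]⟩

theorem card_edgeSet_pathGraph {N : ℕ} (hN : 2 ≤ N) :
    Nat.card (SimpleGraph.pathGraph N).edgeSet = N - 1 := by
  rw [← Fintype.card_fin (N - 1), ← Nat.card_eq_fintype_card]
  refine (Nat.card_congr (Equiv.ofBijective (fun i : Fin (N - 1) =>
    (⟨s(⟨i.1, by lia⟩, ⟨i.1 + 1, by lia⟩), by
      rw [SimpleGraph.mem_edgeSet, SimpleGraph.pathGraph_adj]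
      exact Or.inl rfl⟩ : (SimpleGraph.pathGraph N).edgeSet)) ⟨?_, ?_⟩)).symm
  · intro i j h
    have h1 := congrArg Subtype.val h
    simp only [Sym2.eq_iff, Fin.mk.injEq] at h1
    exact Fin.ext (by lia)
  · rintro ⟨e, he⟩
    induction e using Sym2.ind with
    | _ a b =>
      rw [SimpleGraph.mem_edgeSet, SimpleGraph.pathGraph_adj] at he
      rcases he with h | h
      · refine ⟨⟨a.1, by lia⟩, Subtype.ext ?_⟩
        simp only [h]
      · refine ⟨⟨b.1, by lia⟩, Subtype.ext ?_⟩
        simp only [h]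
        exact Sym2.eq_swap

/-- The edges of a cycle are indexed by their first vertices. -/
def cycleEdge (n : ℕ) : Fin (n + 3) ≃ (SimpleGraph.cycleGraph (n + 3)).edgeSet :=
  Equiv.ofBijective (fun i => ⟨s(i, i + 1), by
    rw [SimpleGraph.mem_edgeSet, SimpleGraph.cycleGraph_adj]
    exact Or.inr (add_sub_cancel_left i 1)⟩) (by
  constructor
  · intro i j h
    have h1 := congrArg Subtype.val h
    simp only [Sym2.eq_iff] at h1
    rcases h1 with h1 | ⟨h1, h2⟩
    · exact h1.1
    · exfalso
      -- A coincidence with reversed orientation would give 2 = 0 modulo n + 3.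
      rw [h1, add_assoc, add_eq_left] at h2
      have := congrArg Fin.val h2
      rw [Fin.val_add] at this
      simp [Nat.mod_eq_of_lt (show 2 < n + 3 by lia)] at this
  · rintro ⟨e, he⟩
    induction e using Sym2.ind with
    | _ a b =>
      rw [SimpleGraph.mem_edgeSet, SimpleGraph.cycleGraph_adj] at he
      rcases he with h | h
      · obtain rfl := sub_eq_iff_eq_add'.1 h
        exact ⟨b, Subtype.ext Sym2.eq_swap⟩
      · obtain rfl := sub_eq_iff_eq_add'.1 h
        exact ⟨a, rfl⟩)

-- With blocks of N = n + 3 symbols, server v sends the sum of its two blocks and, in the clear,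
-- coordinate v of its block of the edge {v, v+1}. For each coordinate j the clear symbol at vertex
-- j opens the cycle, and the sums propagate it both ways up to the wanted edge.
open Fin.CommRing in
theorem exists_alignedCode_cycle (n : ℕ) :
    ∃ C : AlignedCode F (graphStorage (SimpleGraph.cycleGraph (n + 3))), C.h = n + 3 ∧
      ∀ k v, entropy (Nat.card F) (C.answerLaw k v) id = (n + 3 : ℕ) + 1 := by
  classical
  let G := SimpleGraph.cycleGraph (n + 3)
  let ε := cycleEdge n
  have hone : (1 : Fin (n + 3)) ≠ 0 := by simp
  have hmem : ∀ {i v}, v ∈ graphStorage G (ε i) → v = i ∨ v = i + 1 := fun {i v} h =>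
    Sym2.mem_iff.1 h
  have hbase : ∀ i, i ∈ graphStorage G (ε i) := fun i => Sym2.mem_mk_left _ _
  have hother : ∀ i, i + 1 ∈ graphStorage G (ε i) := fun i => Sym2.mem_mk_right _ _
  let code : ∀ v, ({e // v ∈ graphStorage G e} → Fin (n + 3) → F) →ₗ[F] (Fin (n + 3 + 1) → F) :=
    fun v => LinearMap.pi (Fin.cons (LinearMap.proj v ∘ₗ LinearMap.proj ⟨ε v, hbase v⟩)
      fun j => LinearMap.proj j ∘ₗ sumMap F (graphStorage G) (n + 3) v)
  have hcode0 : ∀ v z, code v z 0 = z ⟨ε v, hbase v⟩ v := fun v z => rfl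
  have hcode : ∀ v z j, code v z (Fin.succ j) = sumMap F (graphStorage G) (n + 3) v z j :=
    fun v z j => rfl
  obtain ⟨C, hh, _, hC⟩ := AlignedCode.exists_static (F := F)
    (ends := graphStorage G) (Nat.succ_pos (n + 2)) ε.symm (fun e => ε.symm e + 1)
    (fun e h => hone (add_eq_left.1 h)) (fun _ => n + 3 + 1) code
    (by
      intro v t
      have hprev : v ∈ graphStorage G (ε (v - 1)) := by
        have := hother (v - 1)
        rwa [sub_add_cancel] at this
      let a : Fin (n + 3) → F := Pi.single v (t 0)
      have hd : (⟨ε v, hbase v⟩ : {e // v ∈ graphStorage G e}) ≠ ⟨ε (v - 1), hprev⟩ := by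
        intro h
        have := ε.injective (congrArg Subtype.val h)
        exact hone (sub_eq_self.1 this.symm)
      -- The edge starting at v supplies the clear symbol; the preceding edge adjusts the sum.
      refine ⟨Pi.single ⟨ε v, hbase v⟩ a + Pi.single ⟨ε (v - 1), hprev⟩
        (fun j => t j.succ - a j), funext fun i => ?_⟩
      induction i using Fin.cases with
      | zero =>
        rw [hcode0, Pi.add_apply, Pi.single_eq_same, Pi.single_eq_of_ne hd, add_zero]
        simp [a]
      | succ j =>
        rw [hcode, map_add, sumMap_single, sumMap_single]
        simp)
    (by
      intro k d hd H
      obtain ⟨a, rfl⟩ := ε.surjective k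
      rw [Equiv.symm_apply_apply]
      have hd' : ∀ i, i ≠ a → d (ε i) (i + 1) = d (ε i) i := fun i hi => by
        have := hd (ε i) fun h => hi (ε.injective h)
        rwa [Equiv.symm_apply_apply] at this
      have hstart : ∀ j, d (ε j) j j = 0 := fun j => by
        have := congrFun (H j) 0
        rwa [hcode0] at this
      have hnext : ∀ i j, d (ε i) (i + 1) j = 0 → d (ε (i + 1)) (i + 1) j = 0 := by
        intro i j hi
        have h1 := congrFun (H (i + 1)) j.succ
        rw [hcode, sumMap_apply_eq ⟨ε (i + 1), hbase _⟩] at h1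
        · exact h1
        · rintro ⟨e, he⟩ hne
          obtain ⟨i', rfl⟩ := ε.surjective e
          rcases hmem he with h | h
          · subst h
            exact absurd rfl hne
          · obtain rfl := add_right_cancel h
            exact hi
      have hprev : ∀ i j, d (ε (i + 1)) (i + 1) j = 0 → d (ε i) (i + 1) j = 0 := by
        intro i j hi
        have h1 := congrFun (H (i + 1)) j.succ
        rw [hcode, sumMap_apply_eq ⟨ε i, hother _⟩] at h1
        · exact h1
        · rintro ⟨e, he⟩ hne
          obtain ⟨i', rfl⟩ := ε.surjective e
          rcases hmem he with h | h
          · subst h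
            exact hi
          · obtain rfl := add_right_cancel h
            exact absurd rfl hne
      have hforward : ∀ j (m : ℕ), (∀ l < m, j + (l : Fin (n + 3)) ≠ a) →
          d (ε (j + m)) (j + m) j = 0 := by
        intro j m
        induction m with
        | zero => intro _; simpa using hstart j
        | succ m ih =>
          intro hm
          have h1 := ih fun l hl => hm l (by lia)
          rw [Nat.cast_succ, ← add_assoc]
          refine hnext _ _ ?_
          rw [hd' _ (hm m (by lia)), h1]
      have hbackward : ∀ j (m : ℕ), (∀ l < m, j - 1 - (l : Fin (n + 3)) ≠ a) →
          d (ε (j - 1 - m)) (j - 1 - m + 1) j = 0 := by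
        intro j m
        induction m with
        | zero =>
          intro _
          refine hprev _ _ ?_
          simpa using hstart j
        | succ m ih =>
          intro hm
          have h1 := ih fun l hl => hm l (by lia)
          rw [hd' _ (hm m (by lia))] at h1
          have h2 : j - 1 - ((m + 1 : ℕ) : Fin (n + 3)) + 1 = j - 1 - m := by
            rw [Nat.cast_succ]
            abel
          refine hprev _ _ ?_
          rw [h2]
          exact h1
      constructor
      · funext j
        -- Going round the cycle from j meets the edge a; at the least such m no earlier edge is the
        -- wanted one, so all of them are tied.
        have hex : ∃ m : ℕ, j + (m : Fin (n + 3)) = a := ⟨(a - j).1, by simp⟩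
        have h1 := hforward j (Nat.find hex) fun l hl => Nat.find_min hex hl
        rwa [Nat.find_spec hex] at h1
      · funext j
        have hex : ∃ m : ℕ, j - 1 - (m : Fin (n + 3)) = a := ⟨(j - 1 - a).1, by simp⟩
        have h1 := hbackward j (Nat.find hex) fun l hl => Nat.find_min hex hl
        rwa [Nat.find_spec hex] at h1)
  exact ⟨C, hh, fun k v => by rw [hC]; push_cast; ring⟩

end

end GraphPIR

namespace GraphPIR

noncomputable section

/-! ### Assembly and arithmetic of the parameters -/

theorem exists_ends {V : Type*} (G : SimpleGraph V) :
    ∃ base other : G.edgeSet → V, (∀ e, graphStorage G e = s(base e, other e)) ∧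
      ∀ e, other e ≠ base e := by
  have h : ∀ e : G.edgeSet, ∃ a b, graphStorage G e = s(a, b) ∧ b ≠ a := by
    rintro ⟨e, he⟩
    induction e using Sym2.ind with
    | _ a b => exact ⟨a, b, rfl, (G.ne_of_adj he).symm⟩
  choose base other hends hne using h
  exact ⟨base, other, hends, hne⟩

theorem rate_le_capacityFR {F : Type*} [Field F] [Finite F] {V E : Type*} [Fintype V] [Finite E]
    {ends : E → Sym2 V} {S : Protocol F ends} (hS : S.IsSPIR) (k : E) :
    ((S.rate k : ℝ) : EReal) ≤ capacityFR F ends :=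
  le_iSup_of_le S (le_iSup_of_le hS (le_iSup_of_le k le_rfl))

theorem optRandomnessRatio_le {F : Type*} [Field F] [Finite F] {V E : Type*} [Finite E]
    {ends : E → Sym2 V} {S : Protocol F ends} (hS : S.IsSPIR) :
    optRandomnessRatio F ends ≤ (S.randomnessRatio : EReal) :=
  iInf_le_of_le S (iInf_le_of_le hS le_rfl)

/-- Both products equal ℓ: the x copies of a block have exactly as many symbols as the N - 1 shares
of length y. -/
theorem xRep_mul {h N : ℕ} : xRep (2 * h) N * h = (N - 1) * yRep (2 * h) N := by
  rw [xRep, yRep, Nat.mul_div_cancel_left h two_pos, Nat.div_mul_cancel (Nat.dvd_lcm_left _ _),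
    Nat.mul_div_cancel' (Nat.dvd_lcm_right _ _)]

theorem xRep_pos {h N : ℕ} (hh : 0 < h) (hN : 2 ≤ N) : 0 < xRep (2 * h) N := by
  rw [xRep, Nat.mul_div_cancel_left h two_pos]
  exact Nat.div_pos (Nat.le_of_dvd (Nat.lcm_pos hh (by lia)) (Nat.dvd_lcm_left _ _)) hh

theorem two_zpow_one_sub (r : ℕ) (hr : 1 ≤ r) :
    (2 : ℝ) ^ (1 - (r : ℤ)) = 1 / 2 ^ (r - 1) := by
  obtain ⟨m, rfl⟩ : ∃ m, r = m + 1 := ⟨r - 1, by lia⟩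
  rw [show (1 : ℤ) - ((m + 1 : ℕ) : ℤ) = -(m : ℤ) by push_cast; ring, zpow_neg, zpow_natCast,
    Nat.add_sub_cancel, one_div]

/-- Here P stands for 2^(r-1), and the fraction is reduced by P(N - 1). -/
theorem rate_eq {P N D : ℝ} (hP : P ≠ 0) (hN : N - 1 ≠ 0) :
    P * 2 * (N - 1) / ((P * 2 - 1) * D * (N - 1) + N) =
      2 / (D * (2 - 1 / P) + N / (N - 1) * (1 / P)) := by
  have h : D * (2 - 1 / P) + N / (N - 1) * (1 / P) =
      ((P * 2 - 1) * D * (N - 1) + N) / (P * (N - 1)) := by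
    field_simp
  rw [h, div_div_eq_mul_div]
  ring

end

end GraphPIR
open GraphPIR in
theorem mainTheorem11 {F : Type*} [Field F] [Finite F] (r : ℕ) (hr : 1 ≤ r) :
    -- the general conversion
    (∀ (V : Type*) [Fintype V] (G : SimpleGraph V), G.Connected →
      ∀ (N K' : ℕ), N = Fintype.card V → K' = Nat.card G.edgeSet → 2 ≤ N →
      ∀ T : Protocol F (graphStorage G), T.IsPIR → T.IsLinear → T.SRP →
      ∀ (L' x y : ℕ), L' = T.L → x = xRep L' N → y = yRep L' N →
        (∃ S : Protocol F (multigraphStorage G r), S.IsSPIR ∧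
          S.L = 2 ^ (r - 1) * L' * x ∧
          (∀ (k : G.edgeSet) (τ : Fin r),
            S.rate (k, τ) =
              2 ^ (r - 1) * L' * x / ((2 ^ r - 1) * T.download k * x + N * y)) ∧
          S.numSymbols = (2 ^ r - 1) * T.numSymbols * x + N * y ∧
          S.randomnessRatio =
            (N * y : ℝ) / (2 ^ (r - 1) * x * L') - (K' + 1) / 2 ^ r + K') ∧
        (∀ k : G.edgeSet,
          ((2 ^ (r - 1) * L' * x / ((2 ^ r - 1) * T.download k * x + N * y) : ℝ) : EReal) ≤
            capacityFR F (multigraphStorage G r)) ∧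
        optRandomnessRatio F (multigraphStorage G r) ≤
          (((N * y : ℝ) / (2 ^ (r - 1) * x * L') - (K' + 1) / 2 ^ r + K' : ℝ) : EReal)) ∧
    -- path graphs
    (∀ (N : ℕ), 2 ≤ N → ∀ (R ρ : ℝ),
      R = 2 / (N * (2 - (2 : ℝ) ^ (1 - (r : ℤ))) + (N : ℝ) / (N - 1) * 2 ^ (1 - (r : ℤ))) →
      ρ = 1 / ((N : ℝ) - 1) + N * (N - 2) / (2 * (N - 1)) * (2 - (2 : ℝ) ^ (1 - (r : ℤ))) →
        ρ = 1 / R - 1 ∧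
        (∃ S : Protocol F (multigraphStorage (SimpleGraph.pathGraph N) r), S.IsSPIR ∧
          (∀ θ, S.rate θ = R) ∧ S.randomnessRatio = ρ) ∧
        (R : EReal) ≤ capacityFR F (multigraphStorage (SimpleGraph.pathGraph N) r) ∧
        optRandomnessRatio F (multigraphStorage (SimpleGraph.pathGraph N) r) ≤ (ρ : EReal)) ∧
    -- cyclic graphs
    (∀ (N : ℕ), 3 ≤ N → ∀ (R ρ : ℝ),
      R = 2 / ((N + 1) * (2 - (2 : ℝ) ^ (1 - (r : ℤ))) +
        (N : ℝ) / (N - 1) * 2 ^ (1 - (r : ℤ))) →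
      ρ = 1 / ((N : ℝ) - 1) +
        ((N : ℝ) ^ 2 - N - 1) / (2 * (N - 1)) * (2 - (2 : ℝ) ^ (1 - (r : ℤ))) →
        ρ = 1 / R - 1 ∧
        (∃ S : Protocol F (multigraphStorage (SimpleGraph.cycleGraph N) r), S.IsSPIR ∧
          (∀ θ, S.rate θ = R) ∧ S.randomnessRatio = ρ) ∧
        (R : EReal) ≤ capacityFR F (multigraphStorage (SimpleGraph.cycleGraph N) r) ∧
        optRandomnessRatio F (multigraphStorage (SimpleGraph.cycleGraph N) r) ≤ (ρ : EReal)) := by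
  refine ⟨?_, ?_, ?_⟩
  · intro V _ G hG N K' hNcard hK' hN T hT hlin hS L' x y hL' hx hy
    subst hNcard hK'
    obtain ⟨base, other, hends, hne⟩ := exists_ends G
    -- The evenness of L' is read off from SRP at some edge, so an edge is needed.
    have hE : Nonempty G.edgeSet := by
      obtain ⟨a, b, hab⟩ := Fintype.one_lt_card_iff.1 (by lia : 1 < Fintype.card V)
      have : Nontrivial V := ⟨a, b, hab⟩
      obtain ⟨c, hc⟩ := hG.preconnected.exists_adj_of_nontrivial a
      exact ⟨⟨s(a, c), hc⟩⟩
    obtain ⟨C, hL, hlen, hent⟩ := T.exists_alignedCode hT hlin hS base other hends hne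
    rw [← hL'] at hL
    subst hL
    obtain ⟨S, hS, hSL, hrate, hnum, hratio⟩ := C.exists_scheme hr hN (x := x) (y := y)
      (hx ▸ xRep_pos C.h_pos hN) (by rw [hx, hy]; exact xRep_mul)
    have hrate' : ∀ (k : G.edgeSet) (τ : Fin r), S.rate (k, τ) =
        2 ^ (r - 1) * (2 * C.h : ℕ) * x /
          ((2 ^ r - 1) * T.download k * x + Fintype.card V * y) := by
      intro k τ
      rw [hrate, Finset.sum_congr rfl fun v _ => hent k v, Protocol.download]
      push_cast
      rfl
    have hratio' : S.randomnessRatio = (Fintype.card V * y : ℝ) /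
        (2 ^ (r - 1) * x * (2 * C.h : ℕ)) - (Nat.card G.edgeSet + 1) / 2 ^ r +
          Nat.card G.edgeSet := by
      rw [hratio]
      push_cast
      rfl
    refine ⟨⟨S, hS, hSL, hrate', ?_, hratio'⟩, fun k => ?_, ?_⟩
    · refine hnum.trans ?_
      rw [hlen]
      rfl
    · rw [← hrate' k ⟨0, hr⟩]
      exact rate_le_capacityFR hS _
    · rw [← hratio']
      exact optRandomnessRatio_le hS
  · intro N hN R ρ hR hρ
    obtain ⟨C, hh, hent⟩ := exists_alignedCode_path F hN
    -- Blocks have one symbol, so N - 1 copies provide one symbol for each share.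
    obtain ⟨S, hS, -, hrate, -, hratio⟩ := C.exists_scheme hr (by rwa [Fintype.card_fin])
      (x := N - 1) (y := 1) (by lia) (by rw [hh, Fintype.card_fin])
    rw [two_zpow_one_sub r hr] at hR hρ
    obtain ⟨m, rfl⟩ : ∃ m, r = m + 1 := ⟨r - 1, by lia⟩
    obtain ⟨n, rfl⟩ : ∃ n, N = n + 2 := ⟨N - 2, by lia⟩
    have hn : (0 : ℝ) ≤ n := n.cast_nonneg
    have hrate' : ∀ θ, S.rate θ = R := by
      intro θ
      rw [hrate, hR, hh, Finset.sum_congr rfl fun v _ => hent θ.1 v]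
      simp only [Finset.sum_const, Finset.card_univ, Fintype.card_fin, Nat.add_sub_cancel,
        nsmul_eq_mul, pow_succ, Nat.cast_one]
      rw [Nat.cast_sub (by lia)]
      push_cast
      rw [← rate_eq (by positivity) (by linarith)]
      ring
    have hratio' : S.randomnessRatio = ρ := by
      rw [hratio, hρ, hh, card_edgeSet_pathGraph (by lia)]
      simp only [Fintype.card_fin, Nat.add_sub_cancel, pow_succ, Nat.cast_one]
      rw [Nat.cast_sub (by lia)]
      push_cast
      rw [show (n : ℝ) + 2 - 1 = n + 1 by ring]
      field_simp
      ring
    have hθ : Nonempty (SimpleGraph.pathGraph (n + 2)).edgeSet :=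
      (Nat.card_pos_iff.1 (by rw [card_edgeSet_pathGraph hN]; lia)).1
    obtain ⟨k⟩ := hθ
    refine ⟨?_, ⟨S, hS, hrate', hratio'⟩, ?_, ?_⟩
    · rw [hR, hρ]
      push_cast
      rw [one_div_div, show (n : ℝ) + 2 - 1 = n + 1 by ring]
      field_simp
      ring
    · rw [← hrate' (k, ⟨0, hr⟩)]
      exact rate_le_capacityFR hS _
    · rw [← hratio']
      exact optRandomnessRatio_le hS
  · intro N hN R ρ hR hρ
    obtain ⟨n, rfl⟩ : ∃ n, N = n + 3 := ⟨N - 3, by lia⟩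
    obtain ⟨C, hh, hent⟩ := exists_alignedCode_cycle F n
    -- Blocks have N = n + 3 symbols, so N - 1 copies match shares of length N.
    obtain ⟨S, hS, -, hrate, -, hratio⟩ := C.exists_scheme hr (by rw [Fintype.card_fin]; lia)
      (x := n + 2) (y := n + 3) (by lia) (by rw [hh, Fintype.card_fin]; rfl)
    rw [two_zpow_one_sub r hr] at hR hρ
    obtain ⟨m, rfl⟩ : ∃ m, r = m + 1 := ⟨r - 1, by lia⟩
    have hn : (0 : ℝ) ≤ n := n.cast_nonneg
    have hrate' : ∀ θ, S.rate θ = R := by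
      intro θ
      rw [hrate, hR, hh, Finset.sum_congr rfl fun v _ => hent θ.1 v]
      simp only [Finset.sum_const, Finset.card_univ, Fintype.card_fin, Nat.add_sub_cancel,
        nsmul_eq_mul, pow_succ]
      push_cast
      rw [← rate_eq (by positivity) (by linarith)]
      -- Block length, total download of the code and share length all contain the factor N, which
      -- cancels.
      refine Eq.trans ?_ (mul_div_mul_left _ _ (show (n : ℝ) + 3 ≠ 0 by positivity))
      ring
    have hratio' : S.randomnessRatio = ρ := by
      rw [hratio, hρ, hh, ← Nat.card_congr (cycleEdge n), Nat.card_eq_fintype_card]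
      simp only [Fintype.card_fin, Nat.add_sub_cancel, pow_succ]
      push_cast
      rw [show (n : ℝ) + 3 - 1 = n + 2 by ring]
      field_simp
      ring
    refine ⟨?_, ⟨S, hS, hrate', hratio'⟩, ?_, ?_⟩
    · rw [hR, hρ]
      push_cast
      rw [one_div_div, show (n : ℝ) + 3 - 1 = n + 2 by ring]
      field_simp
      ring
    · rw [← hrate' (cycleEdge n 0, ⟨0, hr⟩)]
      exact rate_le_capacityFR hS _
    · rw [← hratio']
      exact optRandomnessRatio_le hS
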